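/- **Setting.** Let $d\ge 2$ and let $\mathcal X=\{x\in\mathbb R^d: x\ge 0,\ \sum_i x_i=1\}$. An instance consists of a reward vector $\theta\ge 0$ and a risk vector $\zeta\ge 0$ in $\mathbb R^d$, unknown to the learner, with $\|\theta\|_2,\|\zeta\|_2\le 1$, and a safety level $\alpha\in\mathbb R$ which the learner is told. It defines the linear program $\max_{x\in\mathcal X}\langle\theta,x\rangle$ subject to $\langle\zeta,x\rangle\le\alpha$. In round $t$ the learner picks $x_t\in\mathcal X$ as a (possibly randomised) measurable function of the past and then observes conditionally independent Bernoulli variables with means $\langle\theta,x_t\rangle$ and $\langle\zeta,x_t\rangle$. The instance is *LP-easy* if the program has a unique optimal feasible solution $x^*$ and $x^*$ is a vertex of $\mathcal X$. For $\epsilon>0$, $$\mathrm{Regret}^\epsilon_T=\sum_{t\le T}\max\bigl(\langle\theta,x^*-x_t\rangle,\ (\langle\zeta,x_t\rangle-\alpha-\epsilon)_+\bigr).$$ An algorithm (one policy for each $\alpha$) is *consistent* if on every LP-easy instance it plays non-optimal actions sub-polynomially often: for every $x\in\mathcal X$ with $x\ne x^*$ and every $p\in(0,1)$ there is an open neighbourhood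 $U$ of $x$ in $\mathcal X$ with $\mathbb E\bigl[\#\{t\le T:x_t\in U\}\bigr]/T^p\to 0$ as $T\to\infty$. **Gaps.** The $d+2$ constraints $\langle a^i,x\rangle\le\alpha^i$ are: the known equality $\sum_i x_i=1$, the known constraints $-x_i\le 0$, and the unknown constraint $\langle\zeta,x\rangle\le\alpha$; let $[K]$ be the set of known ones. A basic index set (BIS) is a set $I$ of $d$ constraints containing the equality. Write $I\sim x$ if $x\in\mathcal X$ and all constraints in $I$ are active at $x$; $I$ is consistent if $I\sim x$ for some $x$, and suboptimal if $I\not\sim x^*$. For disjoint sets $L$ of constraints and $N\subset[K]$, and $v\in\mathbb R^d$, $\mathrm{spread}(v;L,N)$ is the infimum of $1+\sum_{i\in L\setminus[K]}|w_i|$ over the minimisers $w$ of $\sum_{i\in L\cup N} w_i\alpha^i$ subject to $\sum_{i\in L\cup N} w_ia^i=v$ and $w_i\ge 0$ for $i\in N$. For consistent $I$, $$\Delta_I=\frac{\max\bigl(0,\min_{x: I\sim x}\langle\theta,x^*-x\rangle\bigr)}{\mathrm{spread}(\theta;I,[K]\setminus I)},\qquad \Gamma_I=\max_{k\notin I}\frac{\inf_{x: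 I\sim x}\langle a^k,x\rangle-\alpha^k}{\mathrm{spread}(-a^k;I,[K]\setminus(I\cup\{k\}))},\qquad \Lambda_I=0.$$ For inconsistent $I$, $\Delta_I=\Gamma_I=0$, and, with $\mathcal P(A,B)=\{x:\langle a^i,x\rangle=\alpha^i\ (i\in A),\ \langle a^i,x\rangle\le\alpha^i\ (i\in B)\}$, $$\Lambda_I=\max_{A,B,k}\ \max\left(\frac{\max(0,\inf_{x\in\mathcal P(A,B)}\langle a^k,x\rangle-\alpha^k)}{\mathrm{spread}(-a^k;A,B)},\ \frac{-\min(0,\sup_{x\in\mathcal P(A,B)}\langle a^k,x\rangle-\alpha^k)\,\mathbb 1\{k\in I\}}{\mathrm{spread}(a^k;A,B)}\right),$$ where the maximum is over $A\subset I$, $B\subset[K]\setminus I$ with $\mathcal P(A,B)\ne\varnothing$ and over $k\notin A\cup B$. (By convention $\inf\varnothing=\infty$ for the spread, and a quotient by $\infty$ is $0$.) A feasible point is called non-degenerate if exactly $d$ of the constraints are active at it. **Theorem.** There is an absolute constant $c>0$ such that for every $d\ge2$, all reals $\Xi,\epsilon$ with $0<\Xi<\epsilon$ and $\Xi<1/(\sqrt2+\sqrt{d-1})$,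 and every consistent algorithm there is an LP-easy instance as above, with $x^*$ non-degenerate (and, if $d=2$, with all extreme points of the feasible set non-degenerate), such that every suboptimal BIS $I$ satisfies $\Lambda_I=0$ and $\max(\Delta_I,\Gamma_I)\ge\Xi$, and $$\mathbb E\bigl[\mathrm{Regret}^\epsilon_T\bigr]\ \ge\ c\,\frac{\log T}{\Xi}\qquad\text{for all sufficiently large }T.$$ -/

import Mathlib

open MeasureTheory ProbabilityTheory Filter Topology
open scoped Matrix

noncomputable section

/-! ### Safe linear programs, basic index sets and gaps -/

/-- The data of a safe linear program in `ℝ ^ d`: an objective `θ`, constraint rows `⟨a i, x⟩ ≤ α i`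
(`i : ι`), the set `known` of the rows that the learner knows, and the set `eqs` of those known rows
which the known domain imposes as equalities. -/
structure SafeLP (d : ℕ) (ι : Type) where
  θ : Fin d → ℝ
  a : ι → Fin d → ℝ
  α : ι → ℝ
  known : Finset ι
  eqs : Finset ι
  eqs_subset : eqs ⊆ known

namespace SafeLP

variable {d : ℕ} {ι : Type} [Fintype ι] [DecidableEq ι]

/-- The known domain `𝒦`. -/
def knownDomain (L : SafeLP d ι) : Set (Fin d → ℝ) :=
  {x | (∀ i ∈ L.known, L.a i ⬝ᵥ x ≤ L.α i) ∧ ∀ i ∈ L.eqs, L.a i ⬝ᵥ x = L.α i}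

/-- The feasible set `𝒮`. -/
def feasible (L : SafeLP d ι) : Set (Fin d → ℝ) :=
  {x | x ∈ L.knownDomain ∧ ∀ i, L.a i ⬝ᵥ x ≤ L.α i}

/-- `x` is the unique optimal feasible point. -/
def IsUniqueOptimum (L : SafeLP d ι) (x : Fin d → ℝ) : Prop :=
  x ∈ L.feasible ∧ ∀ y ∈ L.feasible, y ≠ x → L.θ ⬝ᵥ y < L.θ ⬝ᵥ x

/-- Exactly `d` of the constraints are active at `x`. -/
def NondegenerateAt (L : SafeLP d ι) (x : Fin d → ℝ) : Prop :=
  {i | L.a i ⬝ᵥ x = L.α i}.ncard = d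

/-- All basic feasible solutions (extreme points of the feasible set) are non-degenerate. -/
def Nondegenerate (L : SafeLP d ι) : Prop :=
  ∀ x ∈ L.feasible.extremePoints ℝ, L.NondegenerateAt x

/-- A basic index set: `d` constraints, among them all equality constraints. -/
def IsBIS (L : SafeLP d ι) (I : Finset ι) : Prop :=
  I.card = d ∧ L.eqs ⊆ I

/-- The association `I ∼ x`. -/
def Assoc (L : SafeLP d ι) (I : Finset ι) (x : Fin d → ℝ) : Prop :=
  x ∈ L.knownDomain ∧ ∀ i ∈ I, L.a i ⬝ᵥ x = L.α i

/-- `I` is consistent: it is associated with some point. -/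
def ConsistentSet (L : SafeLP d ι) (I : Finset ι) : Prop :=
  ∃ x, L.Assoc I x

/-- `w` is feasible for the program `Π(v; A, B)`: it represents `v` by the rows in `A ∪ B`, with
nonnegative multipliers on `B`. The coordinates of `w` on the unknown part of `A`, on the known part
of `A`, and on `B` are the variables `π`, `ρ` and `σ`. -/
def DualFeasible (L : SafeLP d ι) (v : Fin d → ℝ) (A B : Finset ι) (w : ι → ℝ) : Prop :=
  (∀ i, i ∉ A ∪ B → w i = 0) ∧ (∀ i ∈ B, 0 ≤ w i) ∧ ∑ i, w i • L.a i = v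

/-- `w` is an optimal solution of the program `Π(v; A, B)`. -/
def DualOptimal (L : SafeLP d ι) (v : Fin d → ℝ) (A B : Finset ι) (w : ι → ℝ) : Prop :=
  L.DualFeasible v A B w ∧
    ∀ w', L.DualFeasible v A B w' → ∑ i, w i * L.α i ≤ ∑ i, w' i * L.α i

/-- `spread(v; A, B)`: the infimum of `1 + ‖π‖₁` over the optimal solutions of `Π(v; A, B)`. If there
is no optimal solution this is `0`; as it is only used as a denominator, that case gives the quotient
`0`, as the convention `inf ∅ = ∞` does. -/
def spread (L : SafeLP d ι) (v : Fin d → ℝ) (A B : Finset ι) : ℝ :=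
  sInf {r | ∃ w, L.DualOptimal v A B w ∧ r = 1 + ∑ i ∈ A \ L.known, |w i|}

/-- The efficiency separation `δ(I)`, relative to the optimum `xs`. -/
def effSep (L : SafeLP d ι) (xs : Fin d → ℝ) (I : Finset ι) : ℝ :=
  max 0 (⨅ x : {x // L.Assoc I x}, L.θ ⬝ᵥ (xs - x.1))

open Classical in
/-- The efficiency gap `Δ_I`; it is `0` if `I` is inconsistent. -/
def effGap (L : SafeLP d ι) (xs : Fin d → ℝ) (I : Finset ι) : ℝ :=
  if L.ConsistentSet I then L.effSep xs I / L.spread L.θ I (L.known \ I) else 0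

/-- The feasibility separation `γ(I; k)`. -/
def feasSep (L : SafeLP d ι) (I : Finset ι) (k : ι) : ℝ :=
  ⨅ x : {x // L.Assoc I x}, (L.a k ⬝ᵥ x.1 - L.α k)

open Classical in
/-- The feasibility gap `Γ_I`; it is `0` if `I` is inconsistent. -/
def feasGap (L : SafeLP d ι) (I : Finset ι) : ℝ :=
  if L.ConsistentSet I then
    ⨆ k : {k // k ∉ I}, L.feasSep I k.1 / L.spread (-L.a k.1) I (L.known \ insert k.1 I)
  else 0

/-- The relaxed polyhedron `𝒳(A, B)`: equality on `A`, inequality on `B`. -/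
def relaxed (L : SafeLP d ι) (A B : Finset ι) : Set (Fin d → ℝ) :=
  {x | (∀ i ∈ A, L.a i ⬝ᵥ x = L.α i) ∧ ∀ i ∈ B, L.a i ⬝ᵥ x ≤ L.α i}

/-- The outer consistency separation. (If the infimum is `-∞`, both the mathematical value and the
one below are `0`.) -/
def outerSep (L : SafeLP d ι) (A B : Finset ι) (k : ι) : ℝ :=
  max 0 (⨅ x : L.relaxed A B, (L.a k ⬝ᵥ x.1 - L.α k))

/-- The inner consistency separation of `A ⊆ I`. (If the supremum is `∞`, both the mathematical value
and the one below are `0`.) -/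
def innerSep (L : SafeLP d ι) (I A B : Finset ι) (k : ι) : ℝ :=
  if k ∈ I then -min 0 (⨆ x : L.relaxed A B, (L.a k ⬝ᵥ x.1 - L.α k)) else 0

open Classical in
/-- The consistency gap `Λ_I`; it is `0` if `I` is consistent. The supremum is a maximum over finitely
many choices of `A ⊆ I`, `B ⊆ known \ I` and `k`. -/
def consGap (L : SafeLP d ι) (I : Finset ι) : ℝ :=
  if L.ConsistentSet I then 0
  else sSup {r | ∃ A B : Finset ι, ∃ k : ι, A ⊆ I ∧ B ⊆ L.known \ I ∧
    (L.relaxed A B).Nonempty ∧ k ∉ A ∪ B ∧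
    r = max (L.outerSep A B k / L.spread (-L.a k) A B)
            (L.innerSep I A B k / L.spread (L.a k) A B)}

/-- The `ε`-relaxed regret of playing `x` in one round, relative to the optimum `xs`. -/
def instRegret (L : SafeLP d ι) (xs : Fin d → ℝ) (ε : ℝ) (x : Fin d → ℝ) : ℝ :=
  max (L.θ ⬝ᵥ (xs - x)) (⨆ i, max 0 (L.a i ⬝ᵥ x - L.α i - ε))

end SafeLP

/-! ### Safe linear bandits on the probability simplex -/

/-- The probability simplex in `ℝ ^ d`. -/
abbrev Simplex (d : ℕ) : Type := stdSimplex ℝ (Fin d)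

/-- The constraints: `∑ i, x i = 1` (known), `-x i ≤ 0` (known) and `⟨ζ, x⟩ ≤ α` (unknown). -/
inductive Row (d : ℕ) : Type
  | total : Row d
  | nonneg (i : Fin d) : Row d
  | risk : Row d
  deriving DecidableEq, Fintype

/-- The parameters of an instance: reward vector `θ`, risk vector `ζ`, safety level `α`. The vectors
are nonnegative, of Euclidean norm at most `1`. -/
structure SimplexBandit (d : ℕ) where
  θ : Fin d → ℝ
  ζ : Fin d → ℝ
  α : ℝ
  θ_nonneg : ∀ i, 0 ≤ θ i
  ζ_nonneg : ∀ i, 0 ≤ ζ i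
  θ_norm : ∑ i, θ i ^ 2 ≤ 1
  ζ_norm : ∑ i, ζ i ^ 2 ≤ 1

/-- One round: the action, the observed reward and the observed risk. -/
abbrev Round (d : ℕ) : Type := Simplex d × ℝ × ℝ

/-- A (possibly randomised) policy: the conditional law of the next action given the past. -/
structure Policy (d : ℕ) where
  kernel : ∀ t : ℕ, Kernel (Fin t → Round d) (Simplex d)
  markov : ∀ t, IsMarkovKernel (kernel t)

namespace SimplexBandit

variable {d : ℕ}

/-- The safe linear program of an instance. -/
def toSafeLP (P : SimplexBandit d) : SafeLP d (Row d) where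
  θ := P.θ
  a := fun r => match r with
    | .total => 1
    | .nonneg i => -Pi.single i 1
    | .risk => P.ζ
  α := fun r => match r with
    | .total => 1
    | .nonneg _ => 0
    | .risk => P.α
  known := Finset.univ.erase .risk
  eqs := {.total}
  eqs_subset := by simp

theorem knownDomain_toSafeLP (P : SimplexBandit d) :
    P.toSafeLP.knownDomain = stdSimplex ℝ (Fin d) := by
  ext x
  constructor
  · rintro ⟨h1, h2⟩
    refine ⟨fun i => ?_, ?_⟩
    · have := h1 (.nonneg i) (by simp [toSafeLP])
      simpa [toSafeLP] using this
    · have := h2 .total (by simp [toSafeLP])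
      simpa [toSafeLP, dotProduct] using this
  · rintro ⟨h1, h2⟩
    refine ⟨fun i hi => ?_, fun i hi => ?_⟩
    · rcases i with _ | i | _
      · simp [toSafeLP, dotProduct, h2]
      · simpa [toSafeLP] using h1 i
      · simp [toSafeLP] at hi
    · have : i = .total := by simpa [toSafeLP] using hi
      subst this
      simp [toSafeLP, dotProduct, h2]

theorem mean_mem {v : Fin d → ℝ} (h0 : ∀ i, 0 ≤ v i) (h1 : ∑ i, v i ^ 2 ≤ 1) (x : Simplex d) :
    v ⬝ᵥ x.1 ∈ unitInterval := by
  have hv : ∀ i, v i ≤ 1 := fun i => by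
    have : v i ^ 2 ≤ 1 :=
      (Finset.single_le_sum (f := fun i => v i ^ 2) (fun j _ => sq_nonneg _)
        (Finset.mem_univ i)).trans h1
    nlinarith [h0 i]
  refine ⟨Finset.sum_nonneg fun i _ => mul_nonneg (h0 i) (x.2.1 i), ?_⟩
  calc v ⬝ᵥ x.1 ≤ ∑ i, x.1 i :=
        Finset.sum_le_sum fun i _ => mul_le_of_le_one_left (x.2.1 i) (hv i)
    _ = 1 := x.2.2

/-- The conditional law of a Bernoulli observation with mean `⟨v, x⟩`, given the action `x`. -/
def bernoulliKernel (v : Fin d → ℝ) (h0 : ∀ i, 0 ≤ v i) (h1 : ∑ i, v i ^ 2 ≤ 1) :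
    Kernel (Simplex d) ℝ where
  toFun x := bernoulliMeasure 1 0 ⟨v ⬝ᵥ x.1, mean_mem h0 h1 x⟩
  measurable' := by
    have hm : Measurable fun x : Simplex d => v ⬝ᵥ x.1 := by
      unfold dotProduct
      exact Finset.measurable_sum _ fun i _ =>
        ((measurable_pi_apply i).comp measurable_subtype_coe).const_mul _
    have hq : Measurable fun x : Simplex d =>
        (⟨v ⬝ᵥ x.1, mean_mem h0 h1 x⟩ : unitInterval) := hm.subtype_mk
    have ht : Measurable unitInterval.toNNReal := unitInterval.toNNReal_continuous.measurable
    refine Measure.measurable_of_measurable_coe _ fun s hs => ?_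
    classical
    simp only [bernoulliMeasure_apply _ hs]
    split_ifs
    · fun_prop
    · exact measurable_coe_nnreal_ennreal.comp (ht.comp hq)
    · exact measurable_coe_nnreal_ennreal.comp
        (ht.comp (unitInterval.continuous_symm.measurable.comp hq))
    · fun_prop

instance (v : Fin d → ℝ) (h0 : ∀ i, 0 ≤ v i) (h1 : ∑ i, v i ^ 2 ≤ 1) :
    IsMarkovKernel (bernoulliKernel v h0 h1) :=
  ⟨fun x => by
    change IsProbabilityMeasure (bernoulliMeasure 1 0 _)
    infer_instance⟩

/-- Reward and risk observations, given the action: Bernoulli with means `⟨θ, x⟩` and `⟨ζ, x⟩`,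
independent of each other. -/
def obsKernel (P : SimplexBandit d) : Kernel (Simplex d) (ℝ × ℝ) :=
  bernoulliKernel P.θ P.θ_nonneg P.θ_norm ×ₖ bernoulliKernel P.ζ P.ζ_nonneg P.ζ_norm

instance (P : SimplexBandit d) : IsMarkovKernel P.obsKernel := by
  unfold obsKernel; infer_instance

/-- The conditional law of the round after a history of length `t`. -/
def roundKernel (P : SimplexBandit d) (pol : Policy d) (t : ℕ) :
    Kernel (Fin t → Round d) (Round d) :=
  pol.kernel t ⊗ₖ P.obsKernel.prodMkLeft (Fin t → Round d)

instance (P : SimplexBandit d) (pol : Policy d) (t : ℕ) :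
    IsMarkovKernel (P.roundKernel pol t) := by
  have := pol.markov t
  unfold roundKernel; infer_instance

/-- The law of the first `T` rounds when `pol` is run on the instance `P`. -/
def histLaw (P : SimplexBandit d) (pol : Policy d) : (T : ℕ) → Measure (Fin T → Round d)
  | 0 => Measure.dirac Fin.elim0
  | T + 1 => (P.histLaw pol T ⊗ₘ P.roundKernel pol T).map
      fun p => (Fin.snoc p.1 p.2 : Fin (T + 1) → Round d)

theorem measurable_snoc (T : ℕ) : Measurable
    fun p : (Fin T → Round d) × Round d => (Fin.snoc p.1 p.2 : Fin (T + 1) → Round d) := by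
  refine measurable_pi_iff.2 fun i => ?_
  refine Fin.lastCases ?_ (fun j => ?_) i
  · simpa using measurable_snd
  · simpa [Function.comp_def] using (measurable_pi_apply j).comp measurable_fst

instance (P : SimplexBandit d) (pol : Policy d) (T : ℕ) :
    IsProbabilityMeasure (P.histLaw pol T) := by
  induction T with
  | zero => unfold histLaw; infer_instance
  | succ T ih =>
    unfold histLaw
    exact Measure.isProbabilityMeasure_map (measurable_snoc T).aemeasurable

/-- The expected number of rounds, among the first `T`, whose action lies in `U`. -/
def expCount (P : SimplexBandit d) (pol : Policy d) (U : Set (Simplex d)) (T : ℕ) : ℝ :=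
  ∫ h, ∑ t : Fin T, U.indicator (fun _ => (1 : ℝ)) (h t).1 ∂(P.histLaw pol T)

/-- The expected `ε`-relaxed regret over the first `T` rounds, relative to the optimum `xs`. -/
def expRegret (P : SimplexBandit d) (pol : Policy d) (xs : Fin d → ℝ) (ε : ℝ) (T : ℕ) : ℝ :=
  ∫ h, ∑ t : Fin T, P.toSafeLP.instRegret xs ε (h t).1.1 ∂(P.histLaw pol T)

/-- The instance is LP-easy with optimum `xs`: `xs` is the unique optimal feasible point, and it is an
extreme point of the known domain, that is, a vertex of the simplex. -/
def IsLPEasy (P : SimplexBandit d) (xs : Fin d → ℝ) : Prop :=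
  P.toSafeLP.IsUniqueOptimum xs ∧ xs ∈ P.toSafeLP.knownDomain.extremePoints ℝ

end SimplexBandit

/-- An algorithm (which is told the safety level `α`, but neither `θ` nor `ζ`) is consistent if on every
LP-easy instance it plays sub-polynomially often near every non-optimal action. -/
def IsConsistentAlgorithm {d : ℕ} (alg : ℝ → Policy d) : Prop :=
  ∀ (P : SimplexBandit d) (xs : Fin d → ℝ), P.IsLPEasy xs →
    ∀ x : Simplex d, x.1 ≠ xs → ∀ p : ℝ, 0 < p → p < 1 →
      ∃ U : Set (Simplex d), IsOpen U ∧ x ∈ U ∧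
        Tendsto (fun T : ℕ => P.expCount (alg P.α) U T / (T : ℝ) ^ p) atTop (𝓝 0)

end

open MeasureTheory ProbabilityTheory Filter Topology
open scoped Matrix ENNReal

noncomputable section

/-! ### Tilting a Bernoulli law -/

/-! The hard instance `P` has its optimum at a vertex `z` of reward `m` and risk `0`. All other
vertices have risk `b`; those in a set `J` have reward `m - a`, the rest reward `0`. For `j ∈ J` the
alternative `Q j` raises the reward of `j` to `√2 / 2 > m` and lowers all risks off `z` to `α`, so
that `j` becomes feasible and uniquely optimal. A consistent algorithm stays mostly near `z` under
`P` and mostly near `j` under `Q j`, so under `P` it must collect information of order `log T` about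
the difference. One round carries at most `21 a² x_j`, hence the expected total mass on `j` is at
least `log T / (84 a²)`. Mass off `z` costs at least `a` per unit, which gives regret at least `|J|
log T / (84 a)` (`log_le_integral_sum_apply`, `sum_le_expRegret`).

The change of measure avoids likelihood ratios. Since `log t ≤ t - 1`, the tilt `1 - p / q` bounds
the log-likelihood ratio `log (q / p)` from below; it stays bounded where `P` has reward mean `0`,
and its `P`-mean is minus a chi-square divergence. Tilts add up along a history because both
instances face the same policy (`lintegral_prod_tilt_le`), and a two-point inequality does the rest
(`exp_neg_le_of_tilt`, `log_le_integral_sum`).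

The gap is small although the reward loss need not be: where an edge from `z` meets the risk
constraint, the spread `1 + D / b` divides the loss, `D` being the difference of the end rewards.
With `α = b = 1 / √(d - 1)` and `D = a` the quotient is `a / (1 + a √(d - 1))`, which tends to `1 /
(√2 + √(d - 1))` as `a → √2 / 2`; this is the threshold on `Ξ`. Every suboptimal basic index set is
consistent, so consistency gaps vanish, and efficiency gaps alone reach `Ξ`
(`consGap_eq_zero_and_le_effGap`). Finally `a` and `J` are chosen with `a ≤ 4 Ξ |J|`
(`exists_reward_gap`): one competitor when `a` can be of order `Ξ`, all `d - 1` vertices when `Ξ` is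
near the threshold and `a` must be allowed to be of constant order. -/

/-- A bounded lower estimate of the log-likelihood ratio at `r` of the Bernoulli laws with means
`q` and `p`. -/
def bernoulliTilt (p q r : ℝ) : ℝ :=
  if r = 1 then 1 - p / q else 1 - (1 - p) / (1 - q)

/-- This is `log t ≤ t - 1` at `t = p / q`. At `q = 0` the quotient is the default `0`, which is
harmless only because `p = 0` too. -/
theorem mul_exp_one_sub_div_le {p q : ℝ} (hq : 0 ≤ q) (h : q = 0 → p = 0) :
    p * Real.exp (1 - p / q) ≤ q := by
  rcases hq.eq_or_lt with h0 | h0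
  · simp [h h0.symm, hq]
  · have h1 : p / q ≤ Real.exp (p / q - 1) := by
      have := Real.add_one_le_exp (p / q - 1)
      linarith
    calc p * Real.exp (1 - p / q) = q * ((p / q) * Real.exp (1 - p / q)) := by field_simp
      _ ≤ q * (Real.exp (p / q - 1) * Real.exp (1 - p / q)) := by gcongr
      _ = q := by rw [← Real.exp_add]; simp

theorem measurable_bernoulliTilt {α : Type*} [MeasurableSpace α] {p q r : α → ℝ}
    (hp : Measurable p) (hq : Measurable q) (hr : Measurable r) :
    Measurable fun x => bernoulliTilt (p x) (q x) (r x) := by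
  unfold bernoulliTilt
  exact Measurable.ite (hr (measurableSet_singleton 1)) (by fun_prop) (by fun_prop)

theorem lintegral_bernoulliMeasure_one_zero (p : unitInterval) (f : ℝ → ℝ≥0∞) :
    ∫⁻ r, f r ∂(bernoulliMeasure 1 0 p) =
      ENNReal.ofReal p * f 1 + ENNReal.ofReal (1 - p) * f 0 := by
  have h1 : (unitInterval.toNNReal p : ℝ≥0∞) = ENNReal.ofReal p := by
    rw [ENNReal.ofReal, Real.toNNReal_of_nonneg p.2.1]; rfl
  have h2 : (unitInterval.toNNReal (unitInterval.symm p) : ℝ≥0∞) = ENNReal.ofReal (1 - p) := by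
    rw [ENNReal.ofReal, Real.toNNReal_of_nonneg (sub_nonneg.2 p.2.2)]; rfl
  rw [bernoulliMeasure_def, lintegral_add_measure, lintegral_smul_measure,
    lintegral_smul_measure, lintegral_dirac, lintegral_dirac, ← h1, ← h2]
  rfl

/-- The inequality holds outcome by outcome. The two implications on `p` and `q` express absolute
continuity. -/
theorem lintegral_bernoulliTilt_le (p q : unitInterval) (h0 : (q : ℝ) = 0 → (p : ℝ) = 0)
    (h1 : (q : ℝ) = 1 → (p : ℝ) = 1) (f : ℝ → ℝ≥0∞) :
    ∫⁻ r, ENNReal.ofReal (Real.exp (bernoulliTilt p q r)) * f r ∂(bernoulliMeasure 1 0 p) ≤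
      ∫⁻ r, f r ∂(bernoulliMeasure 1 0 q) := by
  rw [lintegral_bernoulliMeasure_one_zero, lintegral_bernoulliMeasure_one_zero]
  rw [← mul_assoc, ← mul_assoc, ← ENNReal.ofReal_mul p.2.1,
    ← ENNReal.ofReal_mul (sub_nonneg.2 p.2.2)]
  gcongr
  · simpa [bernoulliTilt] using mul_exp_one_sub_div_le q.2.1 h0
  · have := mul_exp_one_sub_div_le (p := 1 - p) (sub_nonneg.2 q.2.2)
      (fun h => sub_eq_zero.2 (h1 (sub_eq_zero.1 h).symm).symm)
    simpa [bernoulliTilt] using this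

/-- The value is minus the chi-square divergence, `-(p - q)² / (q (1 - q))` when `0 < q < 1`. -/
theorem integral_bernoulliTilt (p q : unitInterval) :
    ∫ r, bernoulliTilt p q r ∂(bernoulliMeasure 1 0 p) =
      1 - (p : ℝ) ^ 2 / q - (1 - p : ℝ) ^ 2 / (1 - q) := by
  rw [integral_bernoulliMeasure]
  simp only [bernoulliTilt, smul_eq_mul, if_true, zero_ne_one, if_false]
  ring

namespace SimplexBandit

variable {d : ℕ}

/-! ### Integration over histories -/

theorem lintegral_obsKernel (P : SimplexBandit d) (x : Simplex d) {F : ℝ × ℝ → ℝ≥0∞}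
    (hF : Measurable F) :
    ∫⁻ o, F o ∂P.obsKernel x =
      ∫⁻ r, ∫⁻ s, F (r, s) ∂(bernoulliMeasure 1 0 ⟨P.ζ ⬝ᵥ x.1, mean_mem P.ζ_nonneg P.ζ_norm x⟩)
        ∂(bernoulliMeasure 1 0 ⟨P.θ ⬝ᵥ x.1, mean_mem P.θ_nonneg P.θ_norm x⟩) := by
  unfold obsKernel
  rw [Kernel.prod_apply, lintegral_prod _ hF.aemeasurable]
  rfl

theorem lintegral_roundKernel (P : SimplexBandit d) (pol : Policy d) (T : ℕ)
    (h : Fin T → Round d) {F : Round d → ℝ≥0∞} (hF : Measurable F) :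
    ∫⁻ y, F y ∂P.roundKernel pol T h =
      ∫⁻ x, ∫⁻ o, F (x, o) ∂P.obsKernel x ∂pol.kernel T h := by
  have := pol.markov T
  unfold roundKernel
  rw [Kernel.lintegral_compProd _ _ _ hF]
  rfl

theorem lintegral_histLaw_succ (P : SimplexBandit d) (pol : Policy d) (T : ℕ)
    {F : (Fin (T + 1) → Round d) → ℝ≥0∞} (hF : Measurable F) :
    ∫⁻ h, F h ∂P.histLaw pol (T + 1) =
      ∫⁻ h, ∫⁻ x, ∫⁻ o, F (Fin.snoc h (x, o)) ∂P.obsKernel x ∂pol.kernel T h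
        ∂P.histLaw pol T := by
  have := pol.markov T
  have hF' : Measurable fun p : (Fin T → Round d) × Round d =>
    F (Fin.snoc p.1 p.2 : Fin (T + 1) → Round d) := hF.comp (measurable_snoc T)
  rw [histLaw, lintegral_map hF (measurable_snoc T), Measure.lintegral_compProd hF']
  exact lintegral_congr fun h => P.lintegral_roundKernel pol T h (hF'.comp measurable_prodMk_left)

/-- Change of measure along histories: a tilt that is valid for one observation is valid for the law
of the history, because the policy is the same under both instances. -/
theorem lintegral_prod_tilt_le (P Q : SimplexBandit d) (pol : Policy d) {w : Round d → ℝ≥0∞}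
    (hw : Measurable w)
    (hPQ : ∀ (x : Simplex d) (F : ℝ × ℝ → ℝ≥0∞), Measurable F →
      ∫⁻ o, w (x, o) * F o ∂P.obsKernel x ≤ ∫⁻ o, F o ∂Q.obsKernel x) (T : ℕ)
    {F : (Fin T → Round d) → ℝ≥0∞} (hF : Measurable F) :
    ∫⁻ h, (∏ t, w (h t)) * F h ∂P.histLaw pol T ≤ ∫⁻ h, F h ∂Q.histLaw pol T := by
  induction T with
  | zero => simp [histLaw]
  | succ T ih =>
    have := pol.markov T
    have hwT : ∀ n, Measurable fun h : Fin n → Round d => ∏ t, w (h t) := fun n =>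
      Finset.measurable_prod _ fun t _ => hw.comp (measurable_pi_apply t)
    have hwF : Measurable fun h : Fin (T + 1) → Round d => (∏ t, w (h t)) * F h :=
      (hwT (T + 1)).mul hF
    rw [lintegral_histLaw_succ _ _ _ hwF, lintegral_histLaw_succ _ _ _ hF]
    have hF' : Measurable fun p : (Fin T → Round d) × Round d =>
      F (Fin.snoc p.1 p.2 : Fin (T + 1) → Round d) := hF.comp (measurable_snoc T)
    have hG : Measurable fun h : Fin T → Round d =>
        ∫⁻ x, ∫⁻ o, F (Fin.snoc h (x, o)) ∂Q.obsKernel x ∂pol.kernel T h := by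
      have h1 : Measurable fun h : Fin T → Round d =>
          ∫⁻ y, F (Fin.snoc h y) ∂Q.roundKernel pol T h :=
        hF'.lintegral_kernel_prod_right'
      exact (funext fun h => Q.lintegral_roundKernel pol T h
        (hF'.comp measurable_prodMk_left)) ▸ h1
    refine le_trans (lintegral_mono fun h => ?_) (ih hG)
    have hprod : ∀ (x : Simplex d) (o : ℝ × ℝ),
        ∏ t, w ((Fin.snoc h (x, o) : Fin (T + 1) → Round d) t) = (∏ t, w (h t)) * w (x, o) := by
      intro x o
      rw [Fin.prod_univ_castSucc]
      simp
    have hFh : Measurable fun y : Round d => F (Fin.snoc h y : Fin (T + 1) → Round d) :=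
      hF'.comp measurable_prodMk_left
    simp only [hprod, mul_assoc]
    calc ∫⁻ x, ∫⁻ o, (∏ t, w (h t)) * (w (x, o) * F (Fin.snoc h (x, o))) ∂P.obsKernel x
          ∂pol.kernel T h
        ≤ ∫⁻ x, (∏ t, w (h t)) * ∫⁻ o, F (Fin.snoc h (x, o)) ∂Q.obsKernel x
          ∂pol.kernel T h := by
          refine lintegral_mono fun x => ?_
          have hm : Measurable fun o => F (Fin.snoc h (x, o) : Fin (T + 1) → Round d) :=
            hFh.comp measurable_prodMk_left
          have hwx : Measurable fun o => w (x, o) := hw.comp measurable_prodMk_left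
          dsimp only
          rw [lintegral_const_mul (f := fun o => w (x, o) * F (Fin.snoc h (x, o))) _ (hwx.mul hm)]
          exact mul_le_mul' le_rfl (hPQ x _ hm)
      _ = _ := by
          rw [lintegral_const_mul]
          exact Measurable.lintegral_kernel_prod_right' (κ := Q.obsKernel)
            (f := fun y : Simplex d × ℝ × ℝ => F (Fin.snoc h y : Fin (T + 1) → Round d)) hFh

theorem integral_obsKernel (P : SimplexBandit d) (x : Simplex d) {F : ℝ × ℝ → ℝ} {C : ℝ}
    (hF : Measurable F) (hC : ∀ o, |F o| ≤ C) :
    ∫ o, F o ∂P.obsKernel x =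
      ∫ r, ∫ s, F (r, s) ∂(bernoulliMeasure 1 0 ⟨P.ζ ⬝ᵥ x.1, mean_mem P.ζ_nonneg P.ζ_norm x⟩)
        ∂(bernoulliMeasure 1 0 ⟨P.θ ⬝ᵥ x.1, mean_mem P.θ_nonneg P.θ_norm x⟩) := by
  have hint : Integrable F (P.obsKernel x) :=
    Integrable.of_bound hF.aestronglyMeasurable C (ae_of_all _ hC)
  unfold obsKernel at hint ⊢
  rw [Kernel.prod_apply] at hint ⊢
  rw [integral_prod _ hint]
  rfl

/-- If the mean of `φ` over one observation is nonnegative whatever the action, then so is the mean of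
its sum along the history. -/
theorem integral_sum_nonneg (P : SimplexBandit d) (pol : Policy d) {φ : Round d → ℝ} {C : ℝ}
    (hφ : Measurable φ) (hC : ∀ y, |φ y| ≤ C)
    (h0 : ∀ x : Simplex d, 0 ≤ ∫ o, φ (x, o) ∂P.obsKernel x) (T : ℕ) :
    0 ≤ ∫ h, ∑ t, φ (h t) ∂P.histLaw pol T := by
  induction T with
  | zero => simp
  | succ T ih =>
    have := pol.markov T
    have hm : ∀ n, Measurable fun h : Fin n → Round d => ∑ t, φ (h t) := fun n =>
      Finset.measurable_sum _ fun t _ => hφ.comp (measurable_pi_apply t)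
    have hb : ∀ n, ∀ h : Fin n → Round d, ‖∑ t, φ (h t)‖ ≤ n * C := fun n h => by
      refine (norm_sum_le _ _).trans ?_
      simpa using Finset.sum_le_sum (s := Finset.univ) fun t _ => hC (h t)
    rw [histLaw, integral_map (measurable_snoc T).aemeasurable (hm _).aestronglyMeasurable]
    simp only [Fin.sum_univ_castSucc, Fin.snoc_castSucc, Fin.snoc_last]
    have hi1 : Integrable (fun p : (Fin T → Round d) × Round d => ∑ t, φ (p.1 t))
        (P.histLaw pol T ⊗ₘ P.roundKernel pol T) :=
      Integrable.of_bound ((hm T).comp measurable_fst).aestronglyMeasurable _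
        (ae_of_all _ fun p => hb T p.1)
    have hi2 : Integrable (fun p : (Fin T → Round d) × Round d => φ p.2)
        (P.histLaw pol T ⊗ₘ P.roundKernel pol T) :=
      Integrable.of_bound (hφ.comp measurable_snd).aestronglyMeasurable _
        (ae_of_all _ fun p => hC p.2)
    rw [integral_add hi1 hi2, Measure.integral_compProd hi1, Measure.integral_compProd hi2]
    refine add_nonneg (by simpa using ih) (integral_nonneg fun h => ?_)
    have hi3 : Integrable φ (P.roundKernel pol T h) :=
      Integrable.of_bound hφ.aestronglyMeasurable _ (ae_of_all _ hC)
    dsimp only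
    unfold roundKernel at hi3 ⊢
    rw [ProbabilityTheory.integral_compProd hi3]
    exact integral_nonneg fun x => h0 x

end SimplexBandit

namespace SimplexBandit

variable {d : ℕ}

/-! ### A lower bound for the exploration of a consistent algorithm -/

theorem integral_exp_sum_mul_le (P Q : SimplexBandit d) (pol : Policy d) {Y : Round d → ℝ}
    (hY : Measurable Y)
    (hPQ : ∀ (x : Simplex d) (F : ℝ × ℝ → ℝ≥0∞), Measurable F →
      ∫⁻ o, ENNReal.ofReal (Real.exp (Y (x, o))) * F o ∂P.obsKernel x ≤ ∫⁻ o, F o ∂Q.obsKernel x)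
    (T : ℕ) {f : (Fin T → Round d) → ℝ} (hf : Measurable f) (h0 : ∀ h, 0 ≤ f h)
    (h1 : ∀ h, f h ≤ 1) :
    ∫ h, Real.exp (∑ t, Y (h t)) * f h ∂P.histLaw pol T ≤ ∫ h, f h ∂Q.histLaw pol T := by
  have hS : Measurable fun h : Fin T → Round d => ∑ t, Y (h t) :=
    Finset.measurable_sum _ fun t _ => hY.comp (measurable_pi_apply t)
  rw [integral_eq_lintegral_of_nonneg_ae
      (ae_of_all _ fun h => mul_nonneg (Real.exp_pos _).le (h0 h))
      (hS.exp.mul hf).aestronglyMeasurable,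
    integral_eq_lintegral_of_nonneg_ae (ae_of_all _ h0) hf.aestronglyMeasurable]
  refine ENNReal.toReal_mono ?_ ?_
  · refine ne_top_of_le_ne_top ENNReal.one_ne_top ?_
    calc ∫⁻ h, ENNReal.ofReal (f h) ∂Q.histLaw pol T ≤ ∫⁻ _, 1 ∂Q.histLaw pol T :=
          lintegral_mono fun h => by simpa using h1 h
      _ = 1 := by simp
  · have := lintegral_prod_tilt_le P Q pol (w := fun y => ENNReal.ofReal (Real.exp (Y y)))
      hY.exp.ennreal_ofReal hPQ T hf.ennreal_ofReal
    refine le_trans (le_of_eq (lintegral_congr fun h => ?_)) this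
    rw [ENNReal.ofReal_mul (Real.exp_pos _).le, Real.exp_sum,
      ENNReal.ofReal_prod_of_nonneg fun _ _ => (Real.exp_pos _).le]

/-- A two-point bound: a statistic `f` that separates the laws of the histories under `P` and `Q`
needs an amount of information which is bounded by the expected sum of `g` along the history. -/
theorem exp_neg_le_of_tilt (P Q : SimplexBandit d) (pol : Policy d) {Y : Round d → ℝ} {C κ : ℝ}
    {g : Simplex d → ℝ} (hY : Measurable Y) (hYC : ∀ y, |Y y| ≤ C)
    (hg : Measurable g) (hg1 : ∀ x, |g x| ≤ 1)
    (hPQ : ∀ (x : Simplex d) (F : ℝ × ℝ → ℝ≥0∞), Measurable F →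
      ∫⁻ o, ENNReal.ofReal (Real.exp (Y (x, o))) * F o ∂P.obsKernel x ≤ ∫⁻ o, F o ∂Q.obsKernel x)
    (hκ : ∀ x : Simplex d, 0 ≤ ∫ o, (Y (x, o) + κ * g x) ∂P.obsKernel x)
    (T : ℕ) {f : (Fin T → Round d) → ℝ} (hf : Measurable f) (h0 : ∀ h, 0 ≤ f h)
    (h1 : ∀ h, f h ≤ 1) {u : ℝ} (hu : 0 < u) :
    Real.exp (-(κ / 2 * ∫ h, ∑ t, g (h t).1 ∂P.histLaw pol T)) ≤
      u + (∫ h, f h ∂P.histLaw pol T + ∫ h, (1 - f h) ∂Q.histLaw pol T) / (2 * u) := by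
  set μ := P.histLaw pol T with hμ
  have hS : Measurable fun h : Fin T → Round d => ∑ t, Y (h t) :=
    Finset.measurable_sum _ fun t _ => hY.comp (measurable_pi_apply t)
  have hG : Measurable fun h : Fin T → Round d => ∑ t, g (h t).1 :=
    Finset.measurable_sum _ fun t _ => hg.comp (measurable_fst.comp (measurable_pi_apply t))
  have hSb : ∀ h : Fin T → Round d, |∑ t, Y (h t)| ≤ T * C := fun h => by
    refine (Finset.abs_sum_le_sum_abs _ _).trans ?_
    simpa using Finset.sum_le_sum (s := Finset.univ) fun t _ => hYC (h t)
  have hGb : ∀ h : Fin T → Round d, |∑ t, g (h t).1| ≤ T * 1 := fun h => by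
    refine (Finset.abs_sum_le_sum_abs _ _).trans ?_
    simpa using Finset.sum_le_sum (s := Finset.univ) fun t _ => hg1 (h t).1
  have hE : ∀ c : ℝ, Integrable (fun h => Real.exp (c * ∑ t, Y (h t))) μ := fun c =>
    Integrable.of_bound (hS.const_mul c).exp.aestronglyMeasurable (Real.exp (|c| * (T * C)))
      (ae_of_all _ fun h => by
        rw [Real.norm_eq_abs, Real.abs_exp]
        refine Real.exp_le_exp.2 ((le_abs_self _).trans ?_)
        rw [abs_mul]
        exact mul_le_mul_of_nonneg_left (hSb h) (abs_nonneg _))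
  have hE1 : Integrable (fun h => Real.exp (∑ t, Y (h t))) μ := by simpa using hE 1
  have hfb : ∀ h, ‖f h‖ ≤ 1 := fun h => by
    rw [Real.norm_of_nonneg (h0 h)]; exact h1 h
  have hf1 : Integrable f μ := Integrable.of_bound hf.aestronglyMeasurable 1 (ae_of_all _ hfb)
  have hSi : Integrable (fun h : Fin T → Round d => ∑ t, Y (h t)) μ :=
    Integrable.of_bound hS.aestronglyMeasurable _ (ae_of_all _ hSb)
  have hGi : Integrable (fun h : Fin T → Round d => ∑ t, g (h t).1) μ :=
    Integrable.of_bound hG.aestronglyMeasurable _ (ae_of_all _ hGb)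
  set s := κ / 2 * ∫ h, ∑ t, g (h t).1 ∂μ with hs
  -- Jensen's inequality for `exp`, through its tangent at `-s`, where `-s` is a lower bound for the
  -- mean of half the total tilt.
  have hlow : Real.exp (-s) ≤ ∫ h, Real.exp (1 / 2 * ∑ t, Y (h t)) ∂μ := by
    have hsum := P.integral_sum_nonneg pol (φ := fun y => Y y + κ * g y.1) (C := C + |κ| * 1)
      (hY.add ((hg.comp measurable_fst).const_mul κ))
      (fun y => (abs_add_le _ _).trans (add_le_add (hYC y)
        (by rw [abs_mul]; exact mul_le_mul_of_nonneg_left (hg1 _) (abs_nonneg _)))) hκ T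
    simp only [Finset.sum_add_distrib, ← Finset.mul_sum] at hsum
    rw [integral_add hSi (hGi.const_mul κ), integral_const_mul] at hsum
    have hi : Integrable (fun h => Real.exp (-s) * (1 + s + 1 / 2 * ∑ t, Y (h t))) μ :=
      ((integrable_const (1 + s)).add (hSi.const_mul (1 / 2))).const_mul _
    calc Real.exp (-s) ≤ Real.exp (-s) * (1 + s + 1 / 2 * ∫ h, ∑ t, Y (h t) ∂μ) := by
          refine le_mul_of_one_le_right (Real.exp_pos _).le ?_
          rw [hs]
          linarith
      _ = ∫ h, Real.exp (-s) * (1 + s + 1 / 2 * ∑ t, Y (h t)) ∂μ := by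
          rw [integral_const_mul, integral_add (integrable_const _) (hSi.const_mul _),
            integral_const_mul]
          simp
      _ ≤ _ := by
          refine integral_mono hi (hE _) fun h => ?_
          have := Real.add_one_le_exp (s + 1 / 2 * ∑ t, Y (h t))
          calc Real.exp (-s) * (1 + s + 1 / 2 * ∑ t, Y (h t))
              ≤ Real.exp (-s) * Real.exp (s + 1 / 2 * ∑ t, Y (h t)) := by
                gcongr; linarith
            _ = _ := by rw [← Real.exp_add]; ring_nf
  have hA := integral_exp_sum_mul_le P Q pol hY hPQ T hf h0 h1
  have hB := integral_exp_sum_mul_le P Q pol hY hPQ T (measurable_const.sub hf)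
    (f := fun h => 1 - f h) (fun h => sub_nonneg.2 (h1 h)) (fun h => by linarith [h0 h])
  have hQ : ∫ h, f h ∂Q.histLaw pol T ≤ 1 := by
    calc ∫ h, f h ∂Q.histLaw pol T ≤ ∫ _, 1 ∂Q.histLaw pol T :=
          integral_mono (Integrable.of_bound hf.aestronglyMeasurable 1 (ae_of_all _ hfb))
            (integrable_const _) h1
      _ = 1 := by simp
  have hP : ∫ h, (1 - f h) ∂μ ≤ 1 := by
    rw [integral_sub (integrable_const _) hf1]
    simpa using integral_nonneg h0
  have hi1 : Integrable (fun h => Real.exp (∑ t, Y (h t)) * f h) μ :=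
    hE1.mul_bdd (c := 1) hf.aestronglyMeasurable (ae_of_all _ hfb)
  have hi2 : Integrable (fun h => Real.exp (∑ t, Y (h t)) * (1 - f h)) μ := by
    simpa only [mul_sub, mul_one] using hE1.sub' hi1
  have hi3 : Integrable (fun h => 1 - f h) μ := (integrable_const _).sub hf1
  -- With `b` the square root of the tilted weight, AM-GM gives `b ≤ u b² / 2 + 1 / (2u)` and `b ≤
  -- b² / (2u) + u / 2`. The first is weighted by `f`, the second by `1 - f`, so that only the two
  -- error terms carry the large factor `1 / (2u)`.
  have hup : ∫ h, Real.exp (1 / 2 * ∑ t, Y (h t)) ∂μ ≤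
      u / 2 * ∫ h, Real.exp (∑ t, Y (h t)) * f h ∂μ + 1 / (2 * u) * ∫ h, f h ∂μ +
      (1 / (2 * u) * ∫ h, Real.exp (∑ t, Y (h t)) * (1 - f h) ∂μ + u / 2 * ∫ h, (1 - f h) ∂μ) := by
    have hj1 : Integrable (fun h => u / 2 * (Real.exp (∑ t, Y (h t)) * f h) +
        1 / (2 * u) * f h) μ := (hi1.const_mul _).add (hf1.const_mul _)
    have hj2 : Integrable (fun h => 1 / (2 * u) * (Real.exp (∑ t, Y (h t)) * (1 - f h)) +
        u / 2 * (1 - f h)) μ := (hi2.const_mul _).add (hi3.const_mul _)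
    rw [← integral_const_mul, ← integral_const_mul, ← integral_const_mul, ← integral_const_mul,
      ← integral_add (hi1.const_mul _) (hf1.const_mul _),
      ← integral_add (hi2.const_mul _) (hi3.const_mul _), ← integral_add hj1 hj2]
    refine integral_mono (hE _) (hj1.add hj2) fun h => ?_
    dsimp only [Pi.add_apply]
    set b := Real.exp (1 / 2 * ∑ t, Y (h t)) with hb
    have hbb : Real.exp (∑ t, Y (h t)) = b ^ 2 := by
      rw [hb, ← Real.exp_nat_mul]; congr 1; push_cast; ring
    rw [hbb]
    have hk1 : 0 ≤ f h * (u * b - 1) ^ 2 / (2 * u) := by have := h0 h; positivity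
    have hk2 : 0 ≤ (1 - f h) * (b - u) ^ 2 / (2 * u) := by
      have := sub_nonneg.2 (h1 h); positivity
    have e : u / 2 * (b ^ 2 * f h) + 1 / (2 * u) * f h +
        (1 / (2 * u) * (b ^ 2 * (1 - f h)) + u / 2 * (1 - f h)) - b =
        f h * (u * b - 1) ^ 2 / (2 * u) + (1 - f h) * (b - u) ^ 2 / (2 * u) := by
      field_simp; ring
    linarith
  refine hlow.trans (hup.trans ?_)
  have hu2 : 0 < 1 / (2 * u) := by positivity
  have k1 := mul_le_mul_of_nonneg_left (hA.trans hQ) (by positivity : 0 ≤ u / 2)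
  have k2 := mul_le_mul_of_nonneg_left hB hu2.le
  have k3 := mul_le_mul_of_nonneg_left hP (by positivity : 0 ≤ u / 2)
  have e : (∫ h, f h ∂μ + ∫ h, (1 - f h) ∂Q.histLaw pol T) / (2 * u) =
    1 / (2 * u) * ∫ h, f h ∂μ + 1 / (2 * u) * ∫ h, (1 - f h) ∂Q.histLaw pol T := by ring
  rw [e]
  linarith

theorem integrable_count (P : SimplexBandit d) (pol : Policy d) {U : Set (Simplex d)}
    (hU : MeasurableSet U) (T : ℕ) :
    Integrable (fun h : Fin T → Round d => ∑ t, U.indicator (fun _ => (1 : ℝ)) (h t).1)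
      (P.histLaw pol T) := by
  refine integrable_finsetSum _ fun t _ => Integrable.of_bound
    ((measurable_const.indicator hU).comp
      (measurable_fst.comp (measurable_pi_apply t))).aestronglyMeasurable 1 (ae_of_all _ fun h => ?_)
  by_cases hx : (h t).1 ∈ U <;> simp [hx]

/-- A consistent algorithm plays sub-polynomially often in a closed set of non-optimal actions. -/
theorem _root_.IsConsistentAlgorithm.tendsto_expCount {alg : ℝ → Policy d}
    (halg : IsConsistentAlgorithm alg) {P : SimplexBandit d} {xs : Fin d → ℝ} (hP : P.IsLPEasy xs)
    {K : Set (Simplex d)} (hK : IsClosed K) (hxs : ∀ x ∈ K, x.1 ≠ xs) {p : ℝ} (hp0 : 0 < p)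
    (hp1 : p < 1) :
    Tendsto (fun T : ℕ => P.expCount (alg P.α) K T / (T : ℝ) ^ p) atTop (𝓝 0) := by
  choose! U hUo hxU hUt using fun x hx => halg P xs hP x (hxs x hx) p hp0 hp1
  -- Compactness reduces the count on `K` to finitely many of the local counts that consistency
  -- controls.
  obtain ⟨s, hsK, hs⟩ := hK.isCompact.elim_nhds_subcover U fun x hx => (hUo x hx).mem_nhds (hxU x hx)
  have hsum : Tendsto (fun T : ℕ => ∑ x ∈ s, P.expCount (alg P.α) (U x) T / (T : ℝ) ^ p) atTop
      (𝓝 0) := by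
    simpa using tendsto_finsetSum s fun x hx => hUt x (hsK x hx)
  refine squeeze_zero (fun T => ?_) (fun T => ?_) hsum
  · refine div_nonneg (integral_nonneg fun h => Finset.sum_nonneg fun t _ => ?_) (by positivity)
    exact Set.indicator_nonneg (fun _ _ => zero_le_one) _
  · rw [← Finset.sum_div]
    gcongr
    unfold expCount
    rw [← integral_finsetSum _ fun x hx => integrable_count P _ (hUo x (hsK x hx)).measurableSet T]
    refine integral_mono (integrable_count P _ hK.measurableSet T)
      (integrable_finsetSum _ fun x hx =>
        integrable_count P _ (hUo x (hsK x hx)).measurableSet T) fun h => ?_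
    dsimp only
    rw [Finset.sum_comm]
    refine Finset.sum_le_sum fun t _ => ?_
    have hn : ∀ x ∈ s, 0 ≤ (U x).indicator (fun _ => (1 : ℝ)) (h t).1 := fun x _ =>
      Set.indicator_nonneg (fun _ _ => zero_le_one) _
    by_cases ht : (h t).1 ∈ K
    · obtain ⟨x, hx, hxt⟩ := Set.mem_iUnion₂.1 (hs ht)
      calc _ = (U x).indicator (fun _ => (1 : ℝ)) (h t).1 := by
            rw [Set.indicator_of_mem ht, Set.indicator_of_mem hxt]
        _ ≤ _ := Finset.single_le_sum hn hx
    · rw [Set.indicator_of_notMem ht]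
      exact Finset.sum_nonneg hn

theorem expCount_add_expCount_compl (P : SimplexBandit d) (pol : Policy d) {U : Set (Simplex d)}
    (hU : MeasurableSet U) (T : ℕ) : P.expCount pol U T + P.expCount pol Uᶜ T = T := by
  unfold expCount
  rw [← integral_add (integrable_count P pol hU T) (integrable_count P pol hU.compl T)]
  simp [← Finset.sum_add_distrib, Set.indicator_self_add_compl_apply]

/-- The amount of exploration along `g` that a consistent algorithm needs to distinguish `P` from the
instance `Q`, which has another optimum. -/
theorem log_le_integral_sum {alg : ℝ → Policy d} (halg : IsConsistentAlgorithm alg)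
    {P Q : SimplexBandit d} {xP xQ : Fin d → ℝ} (hP : P.IsLPEasy xP) (hQ : Q.IsLPEasy xQ)
    (hα : P.α = Q.α) (hne : xP ≠ xQ) {Y : Round d → ℝ} {C κ : ℝ}
    {g : Simplex d → ℝ} (hY : Measurable Y) (hYC : ∀ y, |Y y| ≤ C)
    (hg : Measurable g) (hg1 : ∀ x, |g x| ≤ 1)
    (hPQ : ∀ (x : Simplex d) (F : ℝ × ℝ → ℝ≥0∞), Measurable F →
      ∫⁻ o, ENNReal.ofReal (Real.exp (Y (x, o))) * F o ∂P.obsKernel x ≤ ∫⁻ o, F o ∂Q.obsKernel x)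
    (hκ : ∀ x : Simplex d, 0 ≤ ∫ o, (Y (x, o) + κ * g x) ∂P.obsKernel x) :
    ∀ᶠ T : ℕ in atTop,
      Real.log T / 4 ≤ κ * ∫ h, ∑ t, g (h t).1 ∂P.histLaw (alg P.α) T := by
  set U : Set (Simplex d) := {x | dist x.1 xQ < dist xP xQ} with hUdef
  have hUo : IsOpen U := isOpen_lt (by fun_prop) continuous_const
  -- This ball around `xQ` avoids `xP`, so visits are rare under `P`; the closure of its complement
  -- avoids `xQ`, so absences are rare under `Q`. The separating statistic is the fraction of rounds
  -- spent in `K`.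
  set K : Set (Simplex d) := {x | dist x.1 xQ ≤ dist xP xQ / 2} with hKdef
  have hKc : IsClosed K := isClosed_le (by fun_prop) continuous_const
  have hd : 0 < dist xP xQ := dist_pos.2 hne
  have tP := halg.tendsto_expCount hP hKc (fun x hx h => by
    simp only [hKdef, Set.mem_ofPred_eq, h] at hx; linarith) (p := 1 / 2) (by norm_num) (by norm_num)
  have hKo : IsClosed {x : Simplex d | dist xP xQ / 2 ≤ dist x.1 xQ} :=
    isClosed_le continuous_const (by fun_prop)
  have tQ := halg.tendsto_expCount hQ (K := {x | dist xP xQ / 2 ≤ dist x.1 xQ}) hKo (fun x hx h => by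
    simp only [Set.mem_ofPred_eq, h, dist_self] at hx; linarith) (p := 1 / 2)
    (by norm_num) (by norm_num)
  have e1 := tP.eventually (gt_mem_nhds (show (0 : ℝ) < 1 / 2 by norm_num))
  have e2 := tQ.eventually (gt_mem_nhds (show (0 : ℝ) < 1 / 2 by norm_num))
  -- This absorbs the factor `3 / 2` from `key2`, at the cost of half of the resulting `log T / 2`.
  have e3 : ∀ᶠ T : ℕ in atTop, 8 * Real.log (3 / 2) ≤ Real.log T :=
    (Real.tendsto_log_atTop.comp tendsto_natCast_atTop_atTop).eventually_ge_atTop _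
  filter_upwards [e1, e2, e3, eventually_gt_atTop 0] with T h1 h2 h3 h4
  have hT : (0 : ℝ) < T := by exact_mod_cast h4
  -- Both error probabilities are at most `T ^ (-1 / 2) / 2 = u² / 2`, so the two-point bound
  -- becomes `3 / 2 * u`.
  set u : ℝ := (T : ℝ) ^ (-(1 / 4) : ℝ) with hu
  have hu0 : 0 < u := Real.rpow_pos_of_pos hT _
  have hu2 : u ^ 2 * (T : ℝ) = (T : ℝ) ^ (1 / 2 : ℝ) := by
    rw [hu, ← Real.rpow_natCast, ← Real.rpow_mul hT.le]
    nth_rw 2 [← Real.rpow_one (T : ℝ)]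
    rw [← Real.rpow_add hT]; norm_num
  have hTh : (0 : ℝ) < (T : ℝ) ^ (1 / 2 : ℝ) := Real.rpow_pos_of_pos hT _
  rw [div_lt_iff₀ hTh] at h1 h2
  have hind : Measurable (K.indicator fun _ => (1 : ℝ)) :=
    measurable_const.indicator hKc.measurableSet
  have key := exp_neg_le_of_tilt P Q (alg P.α) hY hYC hg hg1 hPQ hκ T
    (f := fun h => (∑ t, K.indicator (fun _ => (1 : ℝ)) (h t).1) / T)
    ((Finset.measurable_sum _ fun t _ =>
      hind.comp (measurable_fst.comp (measurable_pi_apply t))).div_const _)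
    (fun h => div_nonneg (Finset.sum_nonneg fun t _ =>
      Set.indicator_nonneg (fun _ _ => zero_le_one) _) hT.le)
    (fun h => by
      rw [div_le_one hT]
      refine (Finset.sum_le_card_nsmul _ _ 1 fun t _ => ?_).trans (by simp)
      by_cases hx : (h t).1 ∈ K <;> simp [hx]) hu0
  have hf1 : ∫ h : Fin T → Round d, (∑ t, K.indicator (fun _ => (1 : ℝ)) (h t).1) / T
      ∂P.histLaw (alg P.α) T = P.expCount (alg P.α) K T / T := by
    rw [integral_div]; rfl
  have hf2 : ∫ h : Fin T → Round d, (1 - (∑ t, K.indicator (fun _ => (1 : ℝ)) (h t).1) / T)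
      ∂Q.histLaw (alg P.α) T ≤ 1 / 2 * (T : ℝ) ^ (1 / 2 : ℝ) / T := by
    rw [integral_sub (integrable_const _) ((integrable_count Q _ hKc.measurableSet T).div_const _),
      integral_div]
    have hc := expCount_add_expCount_compl Q (alg P.α) hKc.measurableSet T
    have hm : Q.expCount (alg P.α) Kᶜ T ≤
        Q.expCount (alg P.α) {x | dist xP xQ / 2 ≤ dist x.1 xQ} T := by
      refine integral_mono (integrable_count Q _ hKc.measurableSet.compl T)
        (integrable_count Q _ hKo.measurableSet T) fun h => Finset.sum_le_sum fun t _ =>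
        Set.indicator_le_indicator_of_subset (fun x hx => ?_) (fun _ => zero_le_one) _
      simp only [hKdef, Set.mem_compl_iff, Set.mem_ofPred_eq, not_le] at hx ⊢
      exact hx.le
    rw [← hα] at h2
    have : (1 : ℝ) - Q.expCount (alg P.α) K T / T = Q.expCount (alg P.α) Kᶜ T / T := by
      field_simp; linarith
    calc _ = (1 : ℝ) - Q.expCount (alg P.α) K T / T := by simp [expCount]
      _ = _ := this
      _ ≤ _ := by gcongr; exact hm.trans h2.le
  rw [hf1] at key
  have hf3 : P.expCount (alg P.α) K T / T ≤ 1 / 2 * (T : ℝ) ^ (1 / 2 : ℝ) / T := by gcongr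
  rw [← hu2] at hf2 hf3
  have key2 : Real.exp (-(κ / 2 * ∫ h, ∑ t, g (h t).1 ∂P.histLaw (alg P.α) T)) ≤ 3 / 2 * u := by
    refine key.trans ?_
    have : 1 / 2 * (u ^ 2 * (T : ℝ)) / T = u ^ 2 / 2 := by field_simp
    rw [this] at hf2 hf3
    calc _ ≤ u + (u ^ 2 / 2 + u ^ 2 / 2) / (2 * u) := by gcongr
      _ = 3 / 2 * u := by field_simp; ring
  have key3 := Real.log_le_log (Real.exp_pos _) key2
  rw [Real.log_exp, Real.log_mul (by norm_num) hu0.ne', hu, Real.log_rpow hT] at key3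
  linarith

end SimplexBandit

/-! ### Gaps of linear programs on the simplex -/

namespace SafeLP

variable {d : ℕ} {ι : Type} [Fintype ι] [DecidableEq ι]

/-- Weak duality: the primal point `x` certifies optimality of `w` by complementary slackness. -/
theorem dualOptimal_of_complementary (L : SafeLP d ι) {v : Fin d → ℝ} {A B : Finset ι} {w : ι → ℝ}
    {x : Fin d → ℝ} (hw : L.DualFeasible v A B w) (hA : ∀ i ∈ A, L.a i ⬝ᵥ x = L.α i)
    (hB : ∀ i ∈ B, L.a i ⬝ᵥ x ≤ L.α i) (hx : ∀ i ∈ B, w i = 0 ∨ L.a i ⬝ᵥ x = L.α i) :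
    L.DualOptimal v A B w := by
  have hval : ∀ w', L.DualFeasible v A B w' → v ⬝ᵥ x = ∑ i, w' i * (L.a i ⬝ᵥ x) := by
    rintro w' ⟨-, -, h⟩
    rw [← h, sum_dotProduct]
    simp
  refine ⟨hw, fun w' hw' => ?_⟩
  calc ∑ i, w i * L.α i = ∑ i, w i * (L.a i ⬝ᵥ x) := by
        refine Finset.sum_congr rfl fun i _ => ?_
        by_cases hiA : i ∈ A
        · rw [hA i hiA]
        by_cases hiB : i ∈ B
        · rcases hx i hiB with h | h <;> simp [h]
        · rw [hw.1 i (by simp [hiA, hiB])]; simp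
    _ = ∑ i, w' i * (L.a i ⬝ᵥ x) := by rw [← hval w hw, ← hval w' hw']
    _ ≤ ∑ i, w' i * L.α i := by
        refine Finset.sum_le_sum fun i _ => ?_
        by_cases hiA : i ∈ A
        · rw [hA i hiA]
        by_cases hiB : i ∈ B
        · exact mul_le_mul_of_nonneg_left (hB i hiB) (hw'.2.1 i hiB)
        · rw [hw'.1 i (by simp [hiA, hiB])]; simp

/-- A single optimal dual solution suffices, because the spread is an infimum and sits in the
denominator. It also makes the spread at least `1`, which excludes the default value `0`. -/
theorem le_effGap (L : SafeLP d ι) {xs : Fin d → ℝ} {I : Finset ι} {x : Fin d → ℝ} {w : ι → ℝ}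
    {δ Ξ : ℝ} (hx : L.Assoc I x) (hw : L.DualFeasible L.θ I (L.known \ I) w)
    (hwx : ∀ i ∈ L.known \ I, w i = 0 ∨ L.a i ⬝ᵥ x = L.α i)
    (hδ : ∀ y, L.Assoc I y → δ ≤ L.θ ⬝ᵥ (xs - y)) (hΞ0 : 0 ≤ Ξ)
    (hΞ : Ξ * (1 + ∑ i ∈ I \ L.known, |w i|) ≤ δ) : Ξ ≤ L.effGap xs I := by
  have hopt : L.DualOptimal L.θ I (L.known \ I) w :=
    L.dualOptimal_of_complementary hw hx.2
      (fun i hi => hx.1.1 i (Finset.mem_sdiff.1 hi).1) hwx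
  have hge : ∀ r ∈ {r | ∃ w, L.DualOptimal L.θ I (L.known \ I) w ∧
      r = 1 + ∑ i ∈ I \ L.known, |w i|}, (1 : ℝ) ≤ r := by
    rintro r ⟨w, -, rfl⟩
    have : 0 ≤ ∑ i ∈ I \ L.known, |w i| := Finset.sum_nonneg fun i _ => abs_nonneg _
    linarith
  have hs1 : 1 ≤ L.spread L.θ I (L.known \ I) := le_csInf ⟨_, w, hopt, rfl⟩ hge
  have hs2 : L.spread L.θ I (L.known \ I) ≤ 1 + ∑ i ∈ I \ L.known, |w i| :=
    csInf_le ⟨1, hge⟩ ⟨w, hopt, rfl⟩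
  have hc : L.ConsistentSet I := ⟨x, hx⟩
  have : Nonempty {y // L.Assoc I y} := ⟨⟨x, hx⟩⟩
  rw [effGap, if_pos hc, le_div_iff₀ (by linarith)]
  calc Ξ * L.spread L.θ I (L.known \ I) ≤ δ := (mul_le_mul_of_nonneg_left hs2 hΞ0).trans hΞ
    _ ≤ ⨅ y : {y // L.Assoc I y}, L.θ ⬝ᵥ (xs - y.1) := le_ciInf fun y => hδ y.1 y.2
    _ ≤ L.effSep xs I := le_max_right _ _

end SafeLP

namespace Row

variable {d : ℕ}

/-- Rows as indices: the simplex has one nonnegativity row for each coordinate, and there are two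
further rows. -/
def equivOption : Row d ≃ Option (Option (Fin d)) where
  toFun r := match r with
    | .total => none
    | .risk => some none
    | .nonneg i => some (some i)
  invFun o := match o with
    | none => .total
    | some none => .risk
    | some (some i) => .nonneg i
  left_inv r := by cases r <;> rfl
  right_inv o := by rcases o with _ | _ | _ <;> rfl

theorem card_eq : Fintype.card (Row d) = d + 2 := by
  rw [Fintype.card_congr equivOption]; simp

theorem sum_eq {M : Type*} [AddCommMonoid M] (f : Row d → M) :
    ∑ r, f r = f .total + (f .risk + ∑ i, f (.nonneg i)) := by
  rw [← equivOption.symm.sum_comp, Fintype.sum_option, Fintype.sum_option]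
  rfl

end Row

/-! ### Vertices, feasibility and dual multipliers on the simplex -/

namespace SimplexBandit

variable {d : ℕ}

theorem single_mem_simplex (z : Fin d) : Pi.single z 1 ∈ stdSimplex ℝ (Fin d) :=
  single_mem_stdSimplex ℝ z

theorem eq_single_of_apply_eq_one {x : Fin d → ℝ} (hx : x ∈ stdSimplex ℝ (Fin d)) {z : Fin d}
    (hz : x z = 1) : x = Pi.single z 1 := by
  have h := hx.2
  rw [← Finset.add_sum_erase _ _ (Finset.mem_univ z), hz] at h
  have h0 := (Finset.sum_eq_zero_iff_of_nonneg fun i _ => hx.1 i).1 (by linarith)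
  ext i
  by_cases hi : i = z
  · subst hi; simpa using hz
  · rw [Pi.single_eq_of_ne hi]; exact h0 i (by simp [hi])

theorem apply_le_one {x : Fin d → ℝ} (hx : x ∈ stdSimplex ℝ (Fin d)) (i : Fin d) : x i ≤ 1 :=
  (mem_Icc_of_mem_stdSimplex hx i).2

/-- A linear functional on the simplex is bounded by its values at the vertices. -/
theorem dotProduct_add_le {v x : Fin d → ℝ} (hx : x ∈ stdSimplex ℝ (Fin d)) {z : Fin d} {a : ℝ}
    (hv : ∀ i, i ≠ z → v i + a ≤ v z) : v ⬝ᵥ x + a * (1 - x z) ≤ v z := by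
  have h := hx.2
  rw [← Finset.add_sum_erase _ _ (Finset.mem_univ z)] at h
  have h1 : ∑ i ∈ Finset.univ.erase z, v i * x i ≤
      ∑ i ∈ Finset.univ.erase z, (v z - a) * x i :=
    Finset.sum_le_sum fun i hi => mul_le_mul_of_nonneg_right
      (by linarith [hv i (Finset.ne_of_mem_erase hi)]) (hx.1 i)
  rw [← Finset.mul_sum] at h1
  rw [dotProduct, ← Finset.add_sum_erase _ _ (Finset.mem_univ z)]
  have : ∑ i ∈ Finset.univ.erase z, x i = 1 - x z := by linarith
  rw [this] at h1
  linarith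

theorem dotProduct_ite {x : Fin d → ℝ} (hx : x ∈ stdSimplex ℝ (Fin d)) (z : Fin d) (b : ℝ) :
    (fun i => if i = z then 0 else b) ⬝ᵥ x = b * (1 - x z) := by
  have h := hx.2
  rw [← Finset.add_sum_erase _ _ (Finset.mem_univ z)] at h
  rw [dotProduct, ← Finset.add_sum_erase _ _ (Finset.mem_univ z), ← h, add_sub_cancel_left,
    Finset.mul_sum]
  simp only [if_true, zero_mul, zero_add]
  refine Finset.sum_congr rfl fun i hi => ?_
  rw [if_neg (Finset.ne_of_mem_erase hi)]

theorem dotProduct_total (P : SimplexBandit d) (x : Fin d → ℝ) :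
    P.toSafeLP.a .total ⬝ᵥ x = ∑ i, x i := by simp [toSafeLP, dotProduct]

theorem dotProduct_nonneg_row (P : SimplexBandit d) (i : Fin d) (x : Fin d → ℝ) :
    P.toSafeLP.a (.nonneg i) ⬝ᵥ x = -x i := by simp [toSafeLP]

theorem assoc_iff (P : SimplexBandit d) {I : Finset (Row d)} (x : Fin d → ℝ) :
    P.toSafeLP.Assoc I x ↔ x ∈ stdSimplex ℝ (Fin d) ∧ (∀ j, .nonneg j ∈ I → x j = 0) ∧
      (.risk ∈ I → P.ζ ⬝ᵥ x = P.α) := by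
  unfold SafeLP.Assoc
  rw [knownDomain_toSafeLP]
  refine and_congr_right fun hx => ⟨fun h => ⟨fun j hj => ?_, fun hr => h _ hr⟩, fun h i hi => ?_⟩
  · have := h _ hj
    rw [dotProduct_nonneg_row] at this
    simpa [toSafeLP] using this
  · rcases i with _ | i | _
    · rw [dotProduct_total, hx.2]; rfl
    · rw [dotProduct_nonneg_row, h.1 i hi]; simp [toSafeLP]
    · exact h.2 hi

theorem mem_feasible_iff (P : SimplexBandit d) (x : Fin d → ℝ) :
    x ∈ P.toSafeLP.feasible ↔ x ∈ stdSimplex ℝ (Fin d) ∧ P.ζ ⬝ᵥ x ≤ P.α := by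
  unfold SafeLP.feasible
  rw [knownDomain_toSafeLP]
  refine and_congr_right fun hx => ⟨fun h => h .risk, fun h i => ?_⟩
  rcases i with _ | i | _
  · rw [dotProduct_total, hx.2]; exact le_rfl
  · rw [dotProduct_nonneg_row]; simpa [toSafeLP] using hx.1 i
  · exact h

/-- A feasible vertex of strictly largest reward wins over the whole simplex, so the risk constraint
need not bind. -/
theorem isLPEasy_single (P : SimplexBandit d) {z : Fin d} (hθ : ∀ i, i ≠ z → P.θ i < P.θ z)
    (hζ : P.ζ z ≤ P.α) : P.IsLPEasy (Pi.single z 1) := by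
  refine ⟨⟨(P.mem_feasible_iff _).2 ⟨single_mem_simplex z, by simpa using hζ⟩, fun y hy hne => ?_⟩, ?_⟩
  · have hy := ((P.mem_feasible_iff _).1 hy).1
    have hyz : y z < 1 := lt_of_le_of_ne (apply_le_one hy z) fun h =>
      hne (eq_single_of_apply_eq_one hy h)
    change P.θ ⬝ᵥ y < P.θ ⬝ᵥ Pi.single z 1
    rw [dotProduct_single, mul_one]
    refine lt_of_not_ge fun hge => ?_
    have h := hy.2
    have h1 : ∑ i, (P.θ z - P.θ i) * y i ≤ 0 := by
      simp only [sub_mul, Finset.sum_sub_distrib, ← Finset.mul_sum, h]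
      simpa [dotProduct] using hge
    have hnn : ∀ i ∈ Finset.univ, 0 ≤ (P.θ z - P.θ i) * y i := fun i _ => by
      by_cases hi : i = z
      · simp [hi]
      · exact mul_nonneg (sub_nonneg.2 (hθ i hi).le) (hy.1 i)
    have h2 := (Finset.sum_eq_zero_iff_of_nonneg hnn).1 (le_antisymm h1 (Finset.sum_nonneg hnn))
    rw [← Finset.add_sum_erase _ _ (Finset.mem_univ z), Finset.sum_eq_zero] at h
    · linarith
    · intro i hi
      rcases mul_eq_zero.1 (h2 i (Finset.mem_univ i)) with h3 | h3
      · linarith [hθ i (Finset.ne_of_mem_erase hi)]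
      · exact h3
  · rw [knownDomain_toSafeLP, mem_extremePoints]
    have key : ∀ y₁ ∈ stdSimplex ℝ (Fin d), ∀ y₂ ∈ stdSimplex ℝ (Fin d),
        (Pi.single z 1 : Fin d → ℝ) ∈ openSegment ℝ y₁ y₂ → y₁ z = 1 ∧ y₂ z = 1 := by
      rintro y₁ h₁ y₂ h₂ ⟨s, t, hs, ht, hst, h⟩
      have hz := congrFun h z
      simp only [Pi.add_apply, Pi.smul_apply, smul_eq_mul, Pi.single_eq_same] at hz
      have l1 := apply_le_one h₁ z
      have l2 := apply_le_one h₂ z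
      constructor <;> nlinarith
    refine ⟨single_mem_simplex z, fun y₁ h₁ y₂ h₂ h => ?_⟩
    obtain ⟨e1, e2⟩ := key y₁ h₁ y₂ h₂ h
    exact ⟨eq_single_of_apply_eq_one h₁ e1, eq_single_of_apply_eq_one h₂ e2⟩

theorem nondegenerateAt_single (P : SimplexBandit d) {z : Fin d} (hζ : P.ζ z < P.α) :
    P.toSafeLP.NondegenerateAt (Pi.single z 1) := by
  unfold SafeLP.NondegenerateAt
  have : {i | P.toSafeLP.a i ⬝ᵥ Pi.single z 1 = P.toSafeLP.α i} =
      (({.nonneg z, .risk}ᶜ : Finset (Row d)) : Set (Row d)) := by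
    ext i
    rcases i with _ | i | _
    · simp [toSafeLP]
    · rw [Set.mem_ofPred_eq, dotProduct_nonneg_row]
      by_cases h : i = z <;> simp [toSafeLP, h]
    · simpa [toSafeLP] using hζ.ne
  rw [this, Set.ncard_coe_finset, Finset.card_compl, Row.card_eq, Finset.card_pair (by simp)]
  simp

/-- A lower bound for the efficiency gap from multipliers `wt`, `wr` of the total mass and risk
rows. -/
theorem le_effGap_of_multipliers (P : SimplexBandit d) {I : Finset (Row d)} (hI : .total ∈ I)
    {xs x : Fin d → ℝ} {wt wr δ Ξ : ℝ} (hx : P.toSafeLP.Assoc I x) (hr : .risk ∉ I → wr = 0)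
    (hw : ∀ j, .nonneg j ∉ I → 0 ≤ wt + wr * P.ζ j - P.θ j)
    (hwx : ∀ j, .nonneg j ∉ I → wt + wr * P.ζ j - P.θ j = 0 ∨ x j = 0)
    (hδ : ∀ y, P.toSafeLP.Assoc I y → δ ≤ P.θ ⬝ᵥ (xs - y)) (hΞ0 : 0 ≤ Ξ)
    (hΞ : Ξ * (1 + |wr|) ≤ δ) : Ξ ≤ P.toSafeLP.effGap xs I := by
  -- The representation of `θ` forces the multiplier of each nonnegativity row once `wt` and `wr`
  -- are given.
  set w : Row d → ℝ := fun r => match r with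
    | .total => wt
    | .risk => wr
    | .nonneg i => wt + wr * P.ζ i - P.θ i with hwdef
  refine P.toSafeLP.le_effGap (w := w) hx ⟨fun i hi => ?_, fun i hi => ?_, ?_⟩ (fun i hi => ?_)
    hδ hΞ0 ?_
  · rcases i with _ | i | _
    · simp [hI] at hi
    · simp [toSafeLP] at hi
    · exact hr fun h => hi (Finset.mem_union_left _ h)
  · rw [Finset.mem_sdiff] at hi
    rcases i with _ | i | _
    · exact absurd hI hi.2
    · exact hw i hi.2
    · simp [toSafeLP] at hi
  · rw [Row.sum_eq]
    ext k
    simp only [toSafeLP, hwdef, Pi.add_apply, Pi.smul_apply, Finset.sum_apply, smul_eq_mul,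
      Pi.neg_apply, Pi.one_apply, Pi.single_apply]
    simp only [mul_one, mul_neg, mul_ite, mul_zero, Finset.sum_neg_distrib, Finset.sum_ite_eq,
      Finset.mem_univ, if_true]
    ring
  · rw [Finset.mem_sdiff] at hi
    rcases i with _ | i | _
    · exact absurd hI hi.2
    · refine (hwx i hi.2).imp id fun h => ?_
      rw [dotProduct_nonneg_row, h]; simp [toSafeLP]
    · simp [toSafeLP] at hi
  · refine le_trans (mul_le_mul_of_nonneg_left (add_le_add le_rfl ?_) hΞ0) hΞ
    calc ∑ i ∈ I \ P.toSafeLP.known, |w i| ≤ ∑ i ∈ {.risk}, |w i| := by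
          refine Finset.sum_le_sum_of_subset_of_nonneg (fun i hi => ?_) fun _ _ _ => abs_nonneg _
          simpa [toSafeLP] using (Finset.mem_sdiff.1 hi).2
      _ = |wr| := by simp [hwdef]

/-- Of `d + 2` rows exactly two are missing, and the equality is not one of them. -/
theorem isBIS_compl (P : SimplexBandit d) {I : Finset (Row d)} (hI : P.toSafeLP.IsBIS I) :
    .total ∈ I ∧ ((∃ j, ∀ r, r ∉ I ↔ r = .nonneg j ∨ r = .risk) ∨
      ∃ i j, i ≠ j ∧ ∀ r, r ∉ I ↔ r = .nonneg i ∨ r = .nonneg j) := by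
  have ht : Row.total ∈ I := hI.2 (by simp [toSafeLP])
  have hc : Iᶜ.card = 2 := by rw [Finset.card_compl, Row.card_eq, hI.1]; simp
  obtain ⟨p, q, hpq, h⟩ := Finset.card_eq_two.1 hc
  have hr : ∀ r, r ∉ I ↔ r = p ∨ r = q := fun r => by
    rw [← Finset.mem_compl, h]; simp
  have hp : p ≠ .total := fun e => (hr p).2 (Or.inl rfl) (e ▸ ht)
  have hq : q ≠ .total := fun e => (hr q).2 (Or.inr rfl) (e ▸ ht)
  refine ⟨ht, ?_⟩
  rcases p with _ | i | _
  · exact absurd rfl hp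
  · rcases q with _ | j | _
    · exact absurd rfl hq
    · exact Or.inr ⟨i, j, fun e => hpq (by rw [e]), hr⟩
    · exact Or.inl ⟨i, hr⟩
  · rcases q with _ | j | _
    · exact absurd rfl hq
    · exact Or.inl ⟨j, fun r => (hr r).trans or_comm⟩
    · exact absurd rfl hpq

section TwoLevelRisk

/-! Instances in which one coordinate `z` has no risk and all others have the same risk `b`. -/

variable {P : SimplexBandit d} {z : Fin d} {a b Ξ : ℝ}

theorem le_dotProduct_sub (hθ : ∀ i, i ≠ z → P.θ i + a ≤ P.θ z) {x : Fin d → ℝ}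
    (hx : x ∈ stdSimplex ℝ (Fin d)) : a * (1 - x z) ≤ P.θ ⬝ᵥ (Pi.single z 1 - x) := by
  have := dotProduct_add_le hx hθ
  rw [dotProduct_sub, dotProduct_single, mul_one]
  linarith

/-- The best vertex of the face cut out by `I` is optimal with zero multiplier on the risk row, so
the spread is at most `1` while the loss is at least `a`. If the risk row is in `I`, the vertex
satisfies it only when `b = α`. -/
theorem le_effGap_of_vertex (hζ : P.ζ = fun i => if i = z then 0 else b)
    (hθ : ∀ i, i ≠ z → P.θ i + a ≤ P.θ z) (hΞ0 : 0 ≤ Ξ) (hΞa : Ξ ≤ a) {I : Finset (Row d)}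
    (hI : .total ∈ I) (hz : .nonneg z ∈ I) {i : Fin d} (hi : .nonneg i ∉ I)
    (hmax : ∀ j, .nonneg j ∉ I → P.θ j ≤ P.θ i) (hr : .risk ∈ I → b = P.α) :
    P.toSafeLP.ConsistentSet I ∧ Ξ ≤ P.toSafeLP.effGap (Pi.single z 1) I := by
  have hiz : i ≠ z := fun e => hi (e ▸ hz)
  have hx : P.toSafeLP.Assoc I (Pi.single i 1) := by
    refine (P.assoc_iff _).2 ⟨single_mem_simplex i, fun j hj => ?_, fun h => ?_⟩
    · exact Pi.single_eq_of_ne (show j ≠ i from fun e => hi (e ▸ hj)) _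
    · simp [hζ, hiz, hr h]
  refine ⟨⟨_, hx⟩, P.le_effGap_of_multipliers hI (wt := P.θ i) (wr := 0) (δ := a) hx (fun _ => rfl)
    (fun j hj => ?_) (fun j hj => ?_) (fun y hy => ?_) hΞ0 (by simpa using hΞa)⟩
  · have := hmax j hj
    simpa using this
  · by_cases h : j = i
    · left; simp [h]
    · right; exact Pi.single_eq_of_ne h _
  · have hy := (P.assoc_iff _).1 hy
    simpa [hy.2.1 z hz] using le_dotProduct_sub hθ hy.1

/-- The only point is the one on the edge from `z` to `j` with mass `α / b` on `j`. Its loss is `D α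
/ b` and its risk multiplier is `-D / b`, where `D ≥ a` is the reward difference. The quotient `D α
/ (b + D)` is smallest at `D = a`, where it is controlled by `hΞ`. -/
theorem le_effGap_of_edge (hζ : P.ζ = fun i => if i = z then 0 else b) (hb : 0 < b)
    (hα0 : 0 < P.α) (hαb : P.α ≤ b) (ha : 0 < a) (hθ : ∀ i, i ≠ z → P.θ i + a ≤ P.θ z)
    (hΞ0 : 0 ≤ Ξ) (hΞ : Ξ * b ≤ a * (P.α - Ξ)) {I : Finset (Row d)} {j : Fin d} (hj : j ≠ z)
    (hI : .total ∈ I) (hr : .risk ∈ I) (hN : ∀ i, .nonneg i ∉ I ↔ i = z ∨ i = j) :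
    P.toSafeLP.ConsistentSet I ∧ Ξ ≤ P.toSafeLP.effGap (Pi.single z 1) I := by
  set l := P.α / b with hl
  have hl0 : 0 < l := by positivity
  have hl1 : l ≤ 1 := (div_le_one hb).2 hαb
  set x : Fin d → ℝ := (1 - l) • Pi.single z 1 + l • Pi.single j 1 with hxdef
  have hxs : x ∈ stdSimplex ℝ (Fin d) :=
    convex_stdSimplex ℝ (Fin d) (single_mem_simplex z) (single_mem_simplex j)
      (sub_nonneg.2 hl1) hl0.le (by ring)
  have hx0 : ∀ i, i ≠ z → i ≠ j → x i = 0 := fun i h1 h2 => by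
    simp [hxdef, Pi.single_eq_of_ne h1, Pi.single_eq_of_ne h2]
  have hxz : x z = 1 - l := by simp [hxdef, Pi.single_eq_of_ne hj.symm]
  have hx : P.toSafeLP.Assoc I x := by
    refine (P.assoc_iff _).2 ⟨hxs, fun i hi => ?_, fun _ => ?_⟩
    · have := not_or.1 ((not_congr (hN i)).1 (not_not.2 hi))
      exact hx0 i this.1 this.2
    · rw [hζ, dotProduct_ite hxs, hxz, hl]; field_simp; ring
  set D := P.θ z - P.θ j with hD
  have hDa : a ≤ D := by have := hθ j hj; linarith
  refine ⟨⟨x, hx⟩, P.le_effGap_of_multipliers hI (wt := P.θ z) (wr := -(D / b)) (δ := D * l) hx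
    (fun h => absurd hr h) (fun i hi => ?_) (fun i hi => ?_) (fun y hy => ?_) hΞ0 ?_⟩
  · rcases (hN i).1 hi with rfl | rfl
    · simp [hζ]
    · rw [hζ]; simp only [if_neg hj]; rw [hD]; field_simp; linarith
  · left
    rcases (hN i).1 hi with rfl | rfl
    · simp [hζ]
    · rw [hζ]; simp only [if_neg hj]; rw [hD]; field_simp; ring
  · obtain ⟨hy, hy0, hyr⟩ := (P.assoc_iff _).1 hy
    have hyz := hyr hr
    rw [hζ, dotProduct_ite hy] at hyz
    have hlz : 1 - y z = l := by rw [hl]; field_simp; linarith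
    have hzero : ∀ i, i ≠ z ∧ i ≠ j → y i = 0 := fun i hi => hy0 i (by
      by_contra h; exact (not_or.2 hi) ((hN i).1 h))
    have hyj : y z + y j = 1 := by
      rw [← hy.2]
      exact (Fintype.sum_eq_add z j hj.symm hzero).symm
    have hθy : P.θ ⬝ᵥ y = P.θ z * y z + P.θ j * y j :=
      Fintype.sum_eq_add z j hj.symm fun i hi => by rw [hzero i hi, mul_zero]
    change _ ≤ P.θ ⬝ᵥ _
    rw [dotProduct_sub, dotProduct_single, hθy, hD, ← hlz]
    have : y j = 1 - y z := by linarith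
    rw [this]; linarith
  · have hD0 : 0 < D := ha.trans_le hDa
    rw [abs_neg, abs_of_pos (by positivity), hl]
    have hpos : 0 ≤ P.α - Ξ := by
      by_contra h
      have h1 : a * (P.α - Ξ) < 0 := mul_neg_of_pos_of_neg ha (not_le.1 h)
      have h2 : 0 ≤ Ξ * b := by positivity
      linarith
    have h1 : Ξ * b ≤ D * (P.α - Ξ) := hΞ.trans (mul_le_mul_of_nonneg_right hDa hpos)
    have : Ξ * (1 + D / b) = (Ξ * b + Ξ * D) / b := by field_simp
    rw [this, ← mul_div_assoc]
    gcongr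
    linarith

/-- All suboptimal basic index sets are consistent and have a large efficiency gap. -/
theorem consGap_eq_zero_and_le_effGap (hζ : P.ζ = fun i => if i = z then 0 else b) (hb : 0 < b)
    (hα0 : 0 < P.α) (hαb : P.α ≤ b) (hd : d ≠ 2 → P.α = b) (ha : 0 < a)
    (hθ : ∀ i, i ≠ z → P.θ i + a ≤ P.θ z) (hΞ0 : 0 ≤ Ξ) (hΞ : Ξ * b ≤ a * (P.α - Ξ))
    {I : Finset (Row d)} (hI : P.toSafeLP.IsBIS I)
    (hns : ¬ P.toSafeLP.Assoc I (Pi.single z 1)) :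
    P.toSafeLP.consGap I = 0 ∧ Ξ ≤ P.toSafeLP.effGap (Pi.single z 1) I := by
  -- For a consistent set the consistency gap is `0` by definition.
  suffices h : P.toSafeLP.ConsistentSet I ∧ Ξ ≤ P.toSafeLP.effGap (Pi.single z 1) I from
    ⟨if_pos h.1, h.2⟩
  have hΞa : Ξ ≤ a := by
    have h1 : a * (P.α - Ξ) ≤ a * (b - Ξ) := by gcongr
    have h2 : 0 ≤ a * Ξ := by positivity
    exact le_of_mul_le_mul_right (by linarith) hb
  obtain ⟨ht, ⟨j, hj⟩ | ⟨i, j, hij, hN⟩⟩ := P.isBIS_compl hI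
  · have hjz : j ≠ z := by
      rintro rfl
      refine hns ((P.assoc_iff _).2 ⟨single_mem_simplex _, fun i hi => ?_, fun h => ?_⟩)
      · have hij : i ≠ j := fun e => (hj (.nonneg j)).2 (Or.inl rfl) (e ▸ hi)
        exact Pi.single_eq_of_ne hij _
      · exact absurd h ((hj .risk).2 (Or.inr rfl))
    refine le_effGap_of_vertex hζ hθ hΞ0 hΞa ht (i := j) ?_ ((hj _).2 (Or.inl rfl)) (fun k hk => ?_)
      fun h => absurd h ((hj .risk).2 (Or.inr rfl))
    · by_contra h
      simpa [hjz.symm] using (hj _).1 h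
    · have : k = j := by simpa using (hj _).1 hk
      rw [this]
  · have hr : Row.risk ∈ I := by
      by_contra h
      simpa using (hN _).1 h
    by_cases hz : Row.nonneg z ∈ I
    · have hiz : i ≠ z := fun e => (hN (.nonneg i)).2 (Or.inl rfl) (e ▸ hz)
      have hjz : j ≠ z := fun e => (hN (.nonneg j)).2 (Or.inr rfl) (e ▸ hz)
      -- Here `i`, `j`, `z` are distinct, so `d ≥ 3`. The face opposite `z` has constant risk `b`,
      -- and `α = b` is what makes `I` consistent.
      have hd2 : d ≠ 2 := by
        rintro rfl
        omega
      have hbα : Row.risk ∈ I → b = P.α := fun _ => (hd hd2).symm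
      rcases le_total (P.θ j) (P.θ i) with h | h
      · refine le_effGap_of_vertex hζ hθ hΞ0 hΞa ht hz ((hN _).2 (Or.inl rfl)) (fun k hk => ?_) hbα
        rcases (by simpa using (hN _).1 hk : k = i ∨ k = j) with rfl | rfl
        exacts [le_rfl, h]
      · refine le_effGap_of_vertex hζ hθ hΞ0 hΞa ht hz ((hN _).2 (Or.inr rfl)) (fun k hk => ?_) hbα
        rcases (by simpa using (hN _).1 hk : k = i ∨ k = j) with rfl | rfl
        exacts [h, le_rfl]
    · have hN' : ∀ k, Row.nonneg k ∉ I ↔ k = i ∨ k = j := fun k => (hN _).trans (by simp)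
      rcases (hN' z).1 hz with rfl | rfl
      · exact le_effGap_of_edge hζ hb hα0 hαb ha hθ hΞ0 hΞ hij.symm ht hr hN'
      · exact le_effGap_of_edge hζ hb hα0 hαb ha hθ hΞ0 hΞ hij ht hr
          fun k => (hN' k).trans or_comm

end TwoLevelRisk

/-- In the plane, with an active risk constraint between the vertices, the feasible set has no
degenerate extreme point. -/
theorem nondegenerate_of_two {P : SimplexBandit 2} {z : Fin 2} {b : ℝ}
    (hζ : P.ζ = fun i => if i = z then 0 else b) (hα0 : 0 < P.α) (hαb : P.α < b) :
    P.toSafeLP.Nondegenerate := by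
  intro x hx
  have hb : 0 < b := hα0.trans hαb
  obtain ⟨hxS, hxr⟩ := (P.mem_feasible_iff x).1 hx.1
  obtain ⟨j, hj⟩ := exists_ne z
  have hall : ∀ i, i = z ∨ i = j := fun i => by omega
  have hsum : ∀ y : Fin 2 → ℝ, ∑ i, y i = y z + y j := fun y =>
    Fintype.sum_eq_add z j hj.symm fun i hi => absurd (hall i) (not_or.2 hi)
  have hxj : x z + x j = 1 := by rw [← hsum, hxS.2]
  rw [hζ, dotProduct_ite hxS] at hxr
  rcases (apply_le_one hxS z).eq_or_lt with h1 | h1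
  · rw [eq_single_of_apply_eq_one hxS h1]
    exact P.nondegenerateAt_single (by rw [hζ]; simpa using hα0)
  rcases hxr.eq_or_lt with h2 | h2
  · have hxz : 0 < x z := by nlinarith
    have hxj0 : 0 < x j := by linarith
    unfold SafeLP.NondegenerateAt
    have : {i | P.toSafeLP.a i ⬝ᵥ x = P.toSafeLP.α i} =
        (({.total, .risk} : Finset (Row 2)) : Set (Row 2)) := by
      ext i
      rcases i with _ | i | _
      · rw [Set.mem_ofPred_eq, dotProduct_total, hxS.2]; simp [toSafeLP]
      · rw [Set.mem_ofPred_eq, dotProduct_nonneg_row]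
        rcases hall i with rfl | rfl <;> simp [toSafeLP, hxz.ne', hxj0.ne']
      · have : P.ζ ⬝ᵥ x = P.α := by rw [hζ, dotProduct_ite hxS, h2]
        simpa [toSafeLP] using this
    rw [this, Set.ncard_coe_finset, Finset.card_pair (by simp)]
  -- With neither `x z = 1` nor the risk constraint tight, `x` can move both ways along the edge, by
  -- at most the slack `η`, so it is not extreme.
  · exfalso
    set η := min (1 - x z) (P.α / b - (1 - x z)) with hη
    have hη1 : η ≤ 1 - x z := min_le_left _ _
    have hη2 : η ≤ P.α / b - (1 - x z) := min_le_right _ _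
    have hη0 : 0 < η := lt_min (by linarith) (by
      rw [sub_pos, lt_div_iff₀ hb]; linarith)
    have hl1 : P.α / b < 1 := (div_lt_one hb).2 hαb
    set v : Fin 2 → ℝ := Pi.single j η - Pi.single z η with hv
    have hvz : v z = -η := by simp [hv, Pi.single_eq_of_ne hj.symm]
    have hvj : v j = η := by simp [hv, Pi.single_eq_of_ne hj]
    have hmem : ∀ s : ℝ, |s| ≤ 1 → x + s • v ∈ P.toSafeLP.feasible := by
      intro s hs
      obtain ⟨s1, s2⟩ := abs_le.1 hs
      have e1 : (x + s • v) z = x z - s * η := by simp [hvz]; ring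
      have e2 : (x + s • v) j = x j + s * η := by simp [hvj]
      have k1 : s * η ≤ η := by nlinarith
      have k2 : -η ≤ s * η := by nlinarith
      have hS : x + s • v ∈ stdSimplex ℝ (Fin 2) := by
        refine ⟨fun i => ?_, ?_⟩
        · rcases hall i with rfl | rfl
          · rw [e1]; linarith
          · rw [e2]; linarith
        · rw [hsum, e1, e2]; linarith
      refine (P.mem_feasible_iff _).2 ⟨hS, ?_⟩
      rw [hζ, dotProduct_ite hS, e1]
      calc b * (1 - (x z - s * η)) ≤ b * (P.α / b) := by gcongr; linarith
        _ = P.α := by field_simp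
    have hseg : x ∈ openSegment ℝ (x + (1 : ℝ) • v) (x + (-1 : ℝ) • v) :=
      ⟨1 / 2, 1 / 2, by norm_num, by norm_num, by norm_num, by
        ext i; simp; ring⟩
    have hext := hx.2 (hmem 1 (by simp)) (hmem (-1) (by simp)) hseg
    have := congrFun hext z
    simp [hvz] at this
    linarith

end SimplexBandit

/-! ### Information and regret of the two-level instances -/

/-- The chi-square divergence is `(δ y)² / (q (1 - q))`. The bounds on `q` give `y ≤ 5 q (1 - q)`,
so one factor `y` cancels against the variance and the information is linear in the mass `y`, as the
regret is. -/
theorem bernoulli_information_le {p q y a δ : ℝ} (hy : 0 ≤ y) (hp : 0 ≤ p) (hq : q = p + δ * y)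
    (hδ0 : 0 ≤ δ) (hδ : δ ≤ 2 * a) (hqy : √2 / 2 * y ≤ q) (hq1 : q ≤ √2 / 2) :
    0 ≤ 1 - p ^ 2 / q - (1 - p) ^ 2 / (1 - q) + 20 * a ^ 2 * y := by
  have s2 : √2 ^ 2 = 2 := Real.sq_sqrt (by norm_num)
  have s0 : 0 ≤ √2 := Real.sqrt_nonneg 2
  have s1 : 1.4 ≤ √2 := Real.le_sqrt_of_sq_le (by norm_num)
  have s3 : √2 ≤ 1.5 := Real.sqrt_le_iff.2 ⟨by norm_num, by norm_num⟩
  have hy' : 0 ≤ 20 * a ^ 2 * y := by positivity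
  have hδy : 0 ≤ δ * y := by positivity
  rcases (hp.trans (by linarith) : 0 ≤ q).eq_or_lt with h | h
  · have h0 : p = 0 := by linarith
    rw [← h, h0]; norm_num; exact hy'
  · have h1 : 0 < 1 - q := by linarith
    have e : 1 - p ^ 2 / q - (1 - p) ^ 2 / (1 - q) = -((δ * y) ^ 2 / (q * (1 - q))) := by
      have : p = q - δ * y := by linarith
      rw [this]; field_simp; ring
    have hk : y ≤ 5 * (q * (1 - q)) := by
      have h2 : √2 / 2 * y * (1 - √2 / 2) ≤ q * (1 - q) := by
        apply mul_le_mul hqy (by linarith) (by linarith) h.le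
      nlinarith
    rw [e, neg_add_eq_sub, sub_nonneg, div_le_iff₀ (by positivity)]
    have h3 : δ ^ 2 ≤ 4 * a ^ 2 := by nlinarith
    calc (δ * y) ^ 2 = δ ^ 2 * (y * y) := by ring
      _ ≤ 4 * a ^ 2 * (y * (5 * (q * (1 - q)))) := by gcongr
      _ = _ := by ring

/-- The divergence is `((b - α) v)² / (α v (1 - α v))`: one factor `b - α` is absorbed by `1 - α v`,
the other by the hypothesis `h`. -/
theorem bernoulli_information_le_of_scale {v α b a y : ℝ} (hv0 : 0 ≤ v) (hv1 : v ≤ 1) (hy : 0 ≤ y)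
    (hα0 : 0 < α) (hαb : α ≤ b) (hb1 : b ≤ 1) (h : (b - α) * v ≤ α * a ^ 2 * y) :
    0 ≤ 1 - (b * v) ^ 2 / (α * v) - (1 - b * v) ^ 2 / (1 - α * v) + a ^ 2 * y := by
  have hy' : 0 ≤ a ^ 2 * y := by positivity
  rcases hαb.eq_or_lt with rfl | hlt
  · rw [sq, mul_self_div_self, sq, mul_self_div_self]; linarith
  rcases hv0.eq_or_lt with rfl | hv
  · simpa using hy'
  have h1 : b - α ≤ 1 - α * v := by nlinarith
  have h2 : 0 < 1 - α * v := by linarith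
  have e : 1 - (b * v) ^ 2 / (α * v) - (1 - b * v) ^ 2 / (1 - α * v) =
      -(((b - α) * v) ^ 2 / (α * v * (1 - α * v))) := by
    have h3 := h2.ne'
    rw [← neg_div, eq_div_iff (by positivity), sub_mul, sub_mul, div_mul_eq_mul_div,
      div_mul_eq_mul_div, ← mul_assoc, mul_comm (α * v) (1 - α * v), ← mul_assoc]
    field_simp; ring
  rw [e, neg_add_eq_sub, sub_nonneg, div_le_iff₀ (by positivity)]
  calc ((b - α) * v) ^ 2 = (b - α) * v * v * (b - α) := by ring
    _ ≤ (α * a ^ 2 * y) * v * (1 - α * v) := by gcongr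
    _ = _ := by ring

theorem abs_bernoulliTilt_le {p q r R : ℝ} (h0 : 0 ≤ p / q) (h1 : p / q ≤ R)
    (h2 : 0 ≤ (1 - p) / (1 - q)) (h3 : (1 - p) / (1 - q) ≤ R) (hR : 1 ≤ R) :
    |bernoulliTilt p q r| ≤ R := by
  unfold bernoulliTilt
  split_ifs <;> exact abs_le.2 ⟨by linarith, by linarith⟩

/-! ### Tilts of a round, exploration of a coordinate, and regret -/

namespace SimplexBandit

variable {d : ℕ}

theorem continuous_dotProduct (v : Fin d → ℝ) : Continuous fun x : Simplex d => v ⬝ᵥ x.1 := by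
  unfold dotProduct
  exact continuous_finsetSum _ fun i _ =>
    ((continuous_apply i).comp continuous_subtype_val).const_mul _

/-- The sum of the tilts of the two observations. -/
def roundTilt (P Q : SimplexBandit d) (y : Round d) : ℝ :=
  bernoulliTilt (P.θ ⬝ᵥ y.1.1) (Q.θ ⬝ᵥ y.1.1) y.2.1 +
    bernoulliTilt (P.ζ ⬝ᵥ y.1.1) (Q.ζ ⬝ᵥ y.1.1) y.2.2

theorem measurable_roundTilt (P Q : SimplexBandit d) : Measurable (roundTilt P Q) := by
  have h : ∀ v : Fin d → ℝ, Measurable fun y : Round d => v ⬝ᵥ y.1.1 := fun v =>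
    (continuous_dotProduct v).measurable.comp measurable_fst
  exact (measurable_bernoulliTilt (h _) (h _) (by fun_prop)).add
    (measurable_bernoulliTilt (h _) (h _) (by fun_prop))

theorem lintegral_roundTilt_le (P Q : SimplexBandit d) (x : Simplex d)
    (hθ0 : Q.θ ⬝ᵥ x.1 = 0 → P.θ ⬝ᵥ x.1 = 0) (hθ1 : Q.θ ⬝ᵥ x.1 = 1 → P.θ ⬝ᵥ x.1 = 1)
    (hζ0 : Q.ζ ⬝ᵥ x.1 = 0 → P.ζ ⬝ᵥ x.1 = 0) (hζ1 : Q.ζ ⬝ᵥ x.1 = 1 → P.ζ ⬝ᵥ x.1 = 1)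
    {F : ℝ × ℝ → ℝ≥0∞} (hF : Measurable F) :
    ∫⁻ o, ENNReal.ofReal (Real.exp (roundTilt P Q (x, o))) * F o ∂P.obsKernel x ≤
      ∫⁻ o, F o ∂Q.obsKernel x := by
  have hm : Measurable fun o => ENNReal.ofReal (Real.exp (roundTilt P Q (x, o))) * F o :=
    ((measurable_roundTilt P Q).comp measurable_prodMk_left).exp.ennreal_ofReal.mul hF
  rw [lintegral_obsKernel _ _ hm, lintegral_obsKernel _ _ hF]
  refine le_trans (lintegral_mono fun r => ?_) (lintegral_bernoulliTilt_le
    ⟨P.θ ⬝ᵥ x.1, mean_mem P.θ_nonneg P.θ_norm x⟩ ⟨Q.θ ⬝ᵥ x.1, mean_mem Q.θ_nonneg Q.θ_norm x⟩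
    hθ0 hθ1 _)
  simp only [roundTilt, Real.exp_add, ENNReal.ofReal_mul (Real.exp_pos _).le, mul_assoc]
  rw [lintegral_const_mul' _ _ ENNReal.ofReal_ne_top]
  exact mul_le_mul' le_rfl (lintegral_bernoulliTilt_le
    ⟨P.ζ ⬝ᵥ x.1, mean_mem P.ζ_nonneg P.ζ_norm x⟩ ⟨Q.ζ ⬝ᵥ x.1, mean_mem Q.ζ_nonneg Q.ζ_norm x⟩
    hζ0 hζ1 fun s => F (r, s))

theorem integral_roundTilt_add (P Q : SimplexBandit d) {C : ℝ}
    (hC : ∀ y, |roundTilt P Q y| ≤ C) (x : Simplex d) (c : ℝ) :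
    ∫ o, (roundTilt P Q (x, o) + c) ∂P.obsKernel x =
      (1 - (P.θ ⬝ᵥ x.1) ^ 2 / (Q.θ ⬝ᵥ x.1) - (1 - P.θ ⬝ᵥ x.1) ^ 2 / (1 - Q.θ ⬝ᵥ x.1)) +
      (1 - (P.ζ ⬝ᵥ x.1) ^ 2 / (Q.ζ ⬝ᵥ x.1) - (1 - P.ζ ⬝ᵥ x.1) ^ 2 / (1 - Q.ζ ⬝ᵥ x.1)) + c := by
  have h1 := integral_bernoulliTilt ⟨P.θ ⬝ᵥ x.1, mean_mem P.θ_nonneg P.θ_norm x⟩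
    ⟨Q.θ ⬝ᵥ x.1, mean_mem Q.θ_nonneg Q.θ_norm x⟩
  have h2 := integral_bernoulliTilt ⟨P.ζ ⬝ᵥ x.1, mean_mem P.ζ_nonneg P.ζ_norm x⟩
    ⟨Q.ζ ⬝ᵥ x.1, mean_mem Q.ζ_nonneg Q.ζ_norm x⟩
  dsimp only at h1 h2
  have hm : Measurable fun o : ℝ × ℝ => roundTilt P Q (x, o) + c :=
    ((measurable_roundTilt P Q).comp measurable_prodMk_left).add_const c
  rw [integral_obsKernel P x hm (C := C + |c|)
    (fun o => (abs_add_le _ _).trans (add_le_add (hC _) le_rfl)), ← h1, ← h2]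
  simp only [roundTilt]
  have e : ∀ r, ∫ s, (bernoulliTilt (P.θ ⬝ᵥ x.1) (Q.θ ⬝ᵥ x.1) r +
      bernoulliTilt (P.ζ ⬝ᵥ x.1) (Q.ζ ⬝ᵥ x.1) s + c)
      ∂(bernoulliMeasure 1 0 ⟨P.ζ ⬝ᵥ x.1, mean_mem P.ζ_nonneg P.ζ_norm x⟩) =
      bernoulliTilt (P.θ ⬝ᵥ x.1) (Q.θ ⬝ᵥ x.1) r + (∫ s, bernoulliTilt (P.ζ ⬝ᵥ x.1) (Q.ζ ⬝ᵥ x.1) s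
      ∂(bernoulliMeasure 1 0 ⟨P.ζ ⬝ᵥ x.1, mean_mem P.ζ_nonneg P.ζ_norm x⟩) + c) := fun r => by
    rw [integral_add (integrable_bernoulliMeasure _ _ _ _) (integrable_const _),
      integral_add (integrable_const _) (integrable_bernoulliMeasure _ _ _ _)]
    simp [add_assoc]
  simp only [e]
  rw [integral_add (integrable_bernoulliMeasure _ _ _ _) (integrable_const _)]
  simp [add_assoc]

/-- How much a consistent algorithm explores the coordinate `j`, if raising the reward of `j` by `δ`
(and lowering the risk of all vertices other than `z` to the safety level) makes `j` optimal. -/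
theorem log_le_integral_sum_apply {alg : ℝ → Policy d} (halg : IsConsistentAlgorithm alg)
    {P Q : SimplexBandit d} {z j : Fin d} {a b α δ : ℝ} (hjz : j ≠ z)
    (hP : P.IsLPEasy (Pi.single z 1)) (hQ : Q.IsLPEasy (Pi.single j 1)) (hPα : P.α = α)
    (hQα : Q.α = α) (hPζ : P.ζ = fun i => if i = z then 0 else b)
    (hQζ : Q.ζ = fun i => if i = z then 0 else α) (hθ : Q.θ = P.θ + Pi.single j δ)
    (hδ0 : 0 ≤ δ) (hδ : δ ≤ 2 * a) (hj : Q.θ j = √2 / 2) (hle : ∀ i, Q.θ i ≤ √2 / 2)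
    (hα0 : 0 < α) (hαb : α ≤ b) (hb1 : b ≤ 1)
    (hrisk : ∀ x : Simplex d, (b - α) * (1 - x.1 z) ≤ α * a ^ 2 * x.1 j) :
    ∀ᶠ T : ℕ in atTop,
      Real.log T / 4 ≤ 21 * a ^ 2 * ∫ h, ∑ t, (h t).1.1 j ∂P.histLaw (alg P.α) T := by
  have s3 : √2 ≤ 1.5 := Real.sqrt_le_iff.2 ⟨by norm_num, by norm_num⟩
  have hp0 : ∀ x : Simplex d, 0 ≤ P.θ ⬝ᵥ x.1 := fun x => (mean_mem P.θ_nonneg P.θ_norm x).1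
  have hqp : ∀ x : Simplex d, Q.θ ⬝ᵥ x.1 = P.θ ⬝ᵥ x.1 + δ * x.1 j := fun x => by
    rw [hθ, add_dotProduct, single_dotProduct]
  have hpq : ∀ x : Simplex d, P.θ ⬝ᵥ x.1 ≤ Q.θ ⬝ᵥ x.1 := fun x => by
    rw [hqp]; linarith [mul_nonneg hδ0 (x.2.1 j)]
  have hq1 : ∀ x : Simplex d, Q.θ ⬝ᵥ x.1 ≤ √2 / 2 := fun x => by
    calc Q.θ ⬝ᵥ x.1 ≤ ∑ i, √2 / 2 * x.1 i :=
          Finset.sum_le_sum fun i _ => mul_le_mul_of_nonneg_right (hle i) (x.2.1 i)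
      _ = √2 / 2 := by rw [← Finset.mul_sum, x.2.2, mul_one]
  have hqj : ∀ x : Simplex d, √2 / 2 * x.1 j ≤ Q.θ ⬝ᵥ x.1 := fun x => by
    rw [← hj]
    exact Finset.single_le_sum (f := fun i => Q.θ i * x.1 i)
      (fun i _ => mul_nonneg (Q.θ_nonneg i) (x.2.1 i)) (Finset.mem_univ j)
  have hv0 : ∀ x : Simplex d, 0 ≤ 1 - x.1 z := fun x => sub_nonneg.2 (apply_le_one x.2 z)
  have hv1 : ∀ x : Simplex d, 1 - x.1 z ≤ 1 := fun x => by linarith [x.2.1 z]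
  have hPr : ∀ x : Simplex d, P.ζ ⬝ᵥ x.1 = b * (1 - x.1 z) := fun x => by
    rw [hPζ, dotProduct_ite x.2]
  have hQr : ∀ x : Simplex d, Q.ζ ⬝ᵥ x.1 = α * (1 - x.1 z) := fun x => by
    rw [hQζ, dotProduct_ite x.2]
  have hb0 : 0 < b := hα0.trans_le hαb
  have hR : 1 ≤ b / α := (one_le_div hα0).2 hαb
  -- Reward means under `Q` are at most `√2 / 2 ≤ 3 / 4`, which bounds the quotients of the reward
  -- tilt by `4`; those of the risk tilt are at most `b / α`.
  have hC : ∀ y, |roundTilt P Q y| ≤ 4 + b / α := fun y => by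
    refine (abs_add_le _ _).trans (add_le_add ?_ ?_)
    · have l1 := hp0 y.1
      have l2 := hpq y.1
      have l3 := hq1 y.1
      refine abs_bernoulliTilt_le (div_nonneg l1 (l1.trans l2))
        ((div_le_one_of_le₀ l2 (l1.trans l2)).trans (by norm_num))
        (div_nonneg (by linarith) (by linarith)) ?_ (by norm_num)
      rw [div_le_iff₀ (by linarith)]
      linarith
    · rw [hPr, hQr]
      have l1 := hv0 y.1
      have l2 := hv1 y.1
      have l3 : b * (1 - y.1.1 z) ≤ 1 := mul_le_one₀ hb1 l1 l2
      have l4 : α * (1 - y.1.1 z) ≤ b * (1 - y.1.1 z) := by gcongr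
      refine abs_bernoulliTilt_le (by positivity) ?_ (div_nonneg (by linarith) (by linarith))
        ((div_le_one_of_le₀ (by linarith) (by linarith)).trans hR) hR
      rcases l1.eq_or_lt with h | h
      · rw [← h]; simp; positivity
      · rw [mul_div_mul_right _ _ h.ne']
  have hg : Measurable fun x : Simplex d => x.1 j :=
    (measurable_pi_apply j).comp measurable_subtype_coe
  have hne : (Pi.single z 1 : Fin d → ℝ) ≠ Pi.single j 1 := fun h => by
    simpa [hjz] using congrFun h j
  refine log_le_integral_sum halg hP hQ (hPα.trans hQα.symm) hne (measurable_roundTilt P Q) hC hg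
    (fun x => abs_le.2 ⟨by linarith [x.2.1 j], apply_le_one x.2 j⟩)
    (fun x F hF => P.lintegral_roundTilt_le Q x ?_ ?_ ?_ ?_ hF) fun x => ?_
  · intro h
    exact le_antisymm (h ▸ hpq x) (hp0 x)
  · intro h
    linarith [hq1 x]
  · rw [hPr, hQr]
    intro h
    rw [(mul_eq_zero.1 h).resolve_left hα0.ne', mul_zero]
  · rw [hPr, hQr]
    intro h
    have h1 : α * (1 - x.1 z) ≤ b * (1 - x.1 z) := mul_le_mul_of_nonneg_right hαb (hv0 x)
    exact le_antisymm (mul_le_one₀ hb1 (hv0 x) (hv1 x)) (h.symm.le.trans h1)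
  -- The constant `21` is `20` for the reward plus `1` for the risk.
  · rw [integral_roundTilt_add P Q hC x, hPr, hQr]
    have i1 := bernoulli_information_le (x.2.1 j) (hp0 x) (hqp x) hδ0 hδ (hqj x) (hq1 x)
    have i2 := bernoulli_information_le_of_scale (hv0 x) (hv1 x) (x.2.1 j) hα0 hαb hb1 (hrisk x)
    linarith

theorem continuous_instRegret (P : SimplexBandit d) (xs : Fin d → ℝ) (ε : ℝ) :
    Continuous fun x : Simplex d => P.toSafeLP.instRegret xs ε x.1 := by
  unfold SafeLP.instRegret
  have h : ∀ v : Fin d → ℝ, Continuous fun x : Fin d → ℝ => v ⬝ᵥ x := fun v => by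
    unfold dotProduct
    fun_prop
  refine Continuous.max ((h _).comp (by fun_prop)) ?_
  have e : (fun x : Simplex d => ⨆ i, max 0 (P.toSafeLP.a i ⬝ᵥ x.1 - P.toSafeLP.α i - ε)) =
      fun x : Simplex d => Finset.univ.sup' ⟨.total, Finset.mem_univ _⟩
        fun i => max 0 (P.toSafeLP.a i ⬝ᵥ x.1 - P.toSafeLP.α i - ε) := by
    funext x
    have : Nonempty (Row d) := ⟨.total⟩
    rw [Finset.sup'_univ_eq_ciSup]
  rw [e]
  refine Continuous.finset_sup'_apply _ fun i _ => ?_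
  exact continuous_const.max ((((h _).comp continuous_subtype_val).sub continuous_const).sub
    continuous_const)

/-- The regret is at least the gap times the exploration of the suboptimal coordinates. -/
theorem sum_le_expRegret (P : SimplexBandit d) (pol : Policy d) {z : Fin d} {a : ℝ} (ha : 0 ≤ a)
    (hθ : ∀ i, i ≠ z → P.θ i + a ≤ P.θ z) {J : Finset (Fin d)} (hJ : z ∉ J) (ε : ℝ) (T : ℕ) :
    a * ∑ j ∈ J, ∫ h, ∑ t, (h t).1.1 j ∂P.histLaw pol T ≤
      P.expRegret pol (Pi.single z 1) ε T := by
  have hint : ∀ {g : Simplex d → ℝ}, Continuous g →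
      Integrable (fun h : Fin T → Round d => ∑ t, g (h t).1) (P.histLaw pol T) := by
    intro g hg
    obtain ⟨C, hC⟩ := isCompact_univ.exists_bound_of_continuousOn hg.continuousOn
    exact integrable_finsetSum _ fun t _ => Integrable.of_bound
      (hg.measurable.comp (measurable_fst.comp (measurable_pi_apply t))).aestronglyMeasurable C
      (ae_of_all _ fun h => hC _ (Set.mem_univ _))
  have hc : ∀ j : Fin d, Continuous fun x : Simplex d => x.1 j := fun j =>
    (continuous_apply j).comp continuous_subtype_val
  unfold expRegret
  rw [← integral_finsetSum _ fun j _ => hint (hc j), ← integral_const_mul]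
  refine integral_mono ((integrable_finsetSum _ fun j _ => hint (hc j)).const_mul a)
    (hint (P.continuous_instRegret _ ε)) fun h => ?_
  dsimp only
  rw [Finset.sum_comm, Finset.mul_sum]
  refine Finset.sum_le_sum fun t _ => ?_
  have hx := (h t).1.2
  have hsum : ∑ j ∈ J, (h t).1.1 j ≤ 1 - (h t).1.1 z := by
    rw [← hx.2, ← Finset.add_sum_erase _ _ (Finset.mem_univ z), add_sub_cancel_left]
    exact Finset.sum_le_sum_of_subset_of_nonneg
      (fun j hj => Finset.mem_erase.2 ⟨fun e => hJ (e ▸ hj), Finset.mem_univ _⟩)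
      fun j _ _ => hx.1 j
  calc a * ∑ j ∈ J, (h t).1.1 j ≤ a * (1 - (h t).1.1 z) := by gcongr
    _ ≤ P.θ ⬝ᵥ (Pi.single z 1 - (h t).1.1) := le_dotProduct_sub hθ hx
    _ ≤ _ := le_max_left _ _

end SimplexBandit

/-! ### Construction of the hard instances -/

namespace SimplexBandit

variable {d : ℕ}

theorem sum_sq_two_peaks {z j : Fin d} (hj : j ≠ z) (u v : ℝ) :
    ∑ i, (if i = z then u else if i = j then v else 0) ^ 2 = u ^ 2 + v ^ 2 := by
  rw [Fintype.sum_eq_add z j hj.symm fun i hi => by simp [hi.1, hi.2]]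
  simp [hj]

theorem sum_sq_off_peak (z : Fin d) (b : ℝ) :
    ∑ i, (if i = z then 0 else b) ^ 2 = ((d : ℝ) - 1) * b ^ 2 := by
  rw [← Finset.add_sum_erase _ _ (Finset.mem_univ z),
    Finset.sum_congr rfl fun i hi => by rw [if_neg (Finset.ne_of_mem_erase hi)]]
  have : 1 ≤ d := Fin.pos z
  simp [Finset.card_erase_of_mem, Nat.cast_sub this]

/-- Here `hJ` makes all rewards off `z` vanish once `J` has two elements, so that raising one of
them leaves norm at most `√(m² + 1 / 2)`. By `hma` the raise is at most `2 a`, and `haJ` turns `|J|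
/ (84 a)` into `1 / (336 Ξ)`. For `d = 2` the strict `α < b` keeps every extreme point
non-degenerate; otherwise `α = b` keeps every suboptimal index set consistent. -/
theorem exists_instance {z : Fin d} {J : Finset (Fin d)} {Ξ ε a m b α : ℝ} (hzJ : z ∉ J)
    (hJ0 : J.Nonempty) (hJ : ∀ i ∈ J, ∀ j ∈ J, i ≠ j → m = a) (hΞ0 : 0 < Ξ) (ha : 0 < a)
    (ham : a ≤ m) (hm : m < √2 / 2) (hma : √2 / 2 ≤ m + a) (haJ : a ≤ 4 * Ξ * J.card)
    (hα0 : 0 < α) (hαb : α ≤ b) (hb1 : b ≤ 1) (hbd : ((d : ℝ) - 1) * b ^ 2 ≤ 1)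
    (hd : d ≠ 2 → α = b) (hd2 : d = 2 → α < b) (hΞ : Ξ * b ≤ a * (α - Ξ))
    (hrisk : b - α ≤ α * a ^ 2) {alg : ℝ → Policy d} (halg : IsConsistentAlgorithm alg) :
    ∃ (P : SimplexBandit d) (xs : Fin d → ℝ),
      P.IsLPEasy xs ∧
      P.toSafeLP.NondegenerateAt xs ∧
      (d = 2 → P.toSafeLP.Nondegenerate) ∧
      (∀ I : Finset (Row d), P.toSafeLP.IsBIS I → ¬ P.toSafeLP.Assoc I xs →
        P.toSafeLP.consGap I = 0 ∧
        Ξ ≤ max (P.toSafeLP.effGap xs I) (P.toSafeLP.feasGap I)) ∧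
      ∀ᶠ T : ℕ in atTop,
        1 / 336 * (Real.log T / Ξ) ≤ P.expRegret (alg P.α) xs ε T := by
  have s2 : √2 ^ 2 = 2 := Real.sq_sqrt (by norm_num)
  have hb : 0 < b := hα0.trans_le hαb
  have hd1 : (0 : ℝ) ≤ (d : ℝ) - 1 := by
    have : (1 : ℝ) ≤ d := by exact_mod_cast Fin.pos z
    linarith
  have hnorm : m ^ 2 + (√2 / 2) ^ 2 ≤ 1 := by nlinarith
  obtain ⟨j₀, hj₀⟩ := hJ0
  have hne : ∀ {j}, j ∈ J → j ≠ z := fun hj e => hzJ (e ▸ hj)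
  let P : SimplexBandit d :=
    { θ := fun i => if i = z then m else if i ∈ J then m - a else 0
      ζ := fun i => if i = z then 0 else b
      α := α
      θ_nonneg := fun i => by split_ifs <;> linarith
      ζ_nonneg := fun i => by split_ifs <;> linarith
      θ_norm := by
        refine le_trans (Finset.sum_le_sum fun i _ => ?_)
          ((sum_sq_two_peaks (hne hj₀) m (√2 / 2)).trans_le hnorm)
        by_cases hi : i = z
        · simp [hi]
        · simp only [if_neg hi]
          by_cases h : i ∈ J
          · rw [if_pos h]
            by_cases hij : i = j₀
            · rw [if_pos hij]
              exact pow_le_pow_left₀ (by linarith) (by linarith) 2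
            · rw [if_neg hij, hJ i h j₀ hj₀ hij, sub_self]
          · rw [if_neg h]
            rw [zero_pow two_ne_zero]
            exact sq_nonneg _
      ζ_norm := (sum_sq_off_peak z b).trans_le hbd }
  let Q : ∀ j, j ∈ J → SimplexBandit d := fun j hj =>
    { θ := fun i => if i = z then m else if i = j then √2 / 2 else 0
      ζ := fun i => if i = z then 0 else α
      α := α
      θ_nonneg := fun i => by split_ifs <;> linarith
      ζ_nonneg := fun i => by split_ifs <;> linarith
      θ_norm := (sum_sq_two_peaks (hne hj) m (√2 / 2)).trans_le hnorm
      ζ_norm := (sum_sq_off_peak z α).trans_le (le_trans (by gcongr) hbd) }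
  have hPθ : ∀ i, i ≠ z → P.θ i + a ≤ P.θ z := fun i hi => by
    simp only [P, if_neg hi, if_true]
    split_ifs <;> linarith
  have hPz : P.ζ z = 0 := by simp [P]
  have hPeasy : P.IsLPEasy (Pi.single z 1) :=
    P.isLPEasy_single (fun i hi => by linarith [hPθ i hi]) (by rw [hPz]; exact hα0.le)
  refine ⟨P, Pi.single z 1, hPeasy, P.nondegenerateAt_single (by rw [hPz]; exact hα0), ?_, ?_, ?_⟩
  · intro h
    subst h
    exact nondegenerate_of_two (P := P) rfl hα0 (hd2 rfl)
  · intro I hI hns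
    have := consGap_eq_zero_and_le_effGap (P := P) rfl hb hα0 hαb hd ha hPθ hΞ0.le hΞ hI hns
    exact ⟨this.1, this.2.trans (le_max_left _ _)⟩
  · have hexp : ∀ j ∈ J, ∀ᶠ T : ℕ in atTop,
        Real.log T / 4 ≤ 21 * a ^ 2 * ∫ h, ∑ t, (h t).1.1 j ∂P.histLaw (alg P.α) T := by
      intro j hj
      have hjz := hne hj
      refine log_le_integral_sum_apply halg (Q := Q j hj) (δ := √2 / 2 - (m - a)) hjz hPeasy ?_ rfl
        rfl rfl rfl ?_ (by linarith) (by linarith) (by simp [Q, hjz]) (fun i => ?_) hα0 hαb hb1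
        fun x => ?_
      · refine isLPEasy_single _ (fun i hi => ?_) (by simp [Q, hjz])
        simp only [Q, if_neg hi, if_neg hjz, if_true]
        split_ifs
        exacts [hm, by positivity]
      · ext i
        simp only [P, Q, Pi.add_apply]
        by_cases hi : i = z
        · subst hi; simp [hjz.symm]
        · by_cases hij : i = j
          · subst hij; simp [hi, hj]
          · by_cases hiJ : i ∈ J
            · simp [hi, hij, hiJ, hJ i hiJ j hj hij]
            · simp [hi, hij, hiJ]
      · simp only [Q]
        split_ifs
        exacts [hm.le, le_rfl, by positivity]
      -- For `d = 2` the mass off `z` is exactly `x j`, so the change in risk is paid for by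
      -- `hrisk`; for `d ≠ 2` the risks of `P` and `Q` agree.
      · by_cases h2 : d = 2
        · subst h2
          have : x.1 z + x.1 j = 1 := by
            rw [← x.2.2]
            exact (Fintype.sum_eq_add z j hjz.symm fun i hi => by omega).symm
          rw [show 1 - x.1 z = x.1 j by linarith]
          exact mul_le_mul_of_nonneg_right hrisk (x.2.1 j)
        · change (b - α) * _ ≤ α * _ * _
          rw [hd h2, sub_self, zero_mul]
          have := x.2.1 j
          positivity
    filter_upwards [(Filter.eventually_all_finset J).2 hexp] with T hT
    refine le_trans ?_ (P.sum_le_expRegret (alg P.α) ha.le hPθ hzJ ε T)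
    have hlog : 0 ≤ Real.log T := Real.log_natCast_nonneg T
    have hsum : J.card * (Real.log T / (84 * a ^ 2)) ≤
        ∑ j ∈ J, ∫ h, ∑ t, (h t).1.1 j ∂P.histLaw (alg P.α) T := by
      rw [← nsmul_eq_mul]
      refine Finset.card_nsmul_le_sum _ _ _ fun j hj => ?_
      rw [div_le_iff₀ (by positivity)]
      linarith [hT j hj]
    refine le_trans ?_ (mul_le_mul_of_nonneg_left hsum ha.le)
    have e : ∀ n L : ℝ, a * (n * (L / (84 * a ^ 2))) = n * L / (84 * a) := fun n L => by
      field_simp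
    have e' : ∀ L : ℝ, 1 / 336 * (L / Ξ) = L / (336 * Ξ) := fun L => by
      field_simp
    rw [e, e', div_le_div_iff₀ (by positivity) (by positivity)]
    nlinarith [mul_le_mul_of_nonneg_left haJ hlog]

end SimplexBandit

/-! ### Choice of the parameters -/

/-- The strict gap inequality leaves room to put `α` slightly below `b`. The first term of the
maximum keeps the edge gap at least `Ξ`, the second keeps the risk information below the reward
information. -/
theorem exists_safety_level {Ξ a b : ℝ} (hΞ0 : 0 < Ξ) (ha : 0 < a) (hb : 0 < b)
    (h : Ξ * b < a * (b - Ξ)) :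
    ∃ α, 0 < α ∧ α < b ∧ Ξ * b ≤ a * (α - Ξ) ∧ b - α ≤ α * a ^ 2 := by
  refine ⟨max (Ξ + Ξ * b / a) (b / (1 + a ^ 2)), lt_max_of_lt_left (by positivity),
    max_lt ?_ ?_, ?_, ?_⟩
  · have : Ξ * b / a < b - Ξ := by rw [div_lt_iff₀ ha]; linarith
    linarith
  · rw [div_lt_iff₀ (by positivity)]
    have := mul_pos hb (pow_pos ha 2)
    linarith
  · calc Ξ * b = a * (Ξ + Ξ * b / a - Ξ) := by field_simp; ring
      _ ≤ _ := by gcongr; exact le_max_left _ _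
  · have h1 := le_max_right (Ξ + Ξ * b / a) (b / (1 + a ^ 2))
    rw [div_le_iff₀ (by positivity)] at h1
    linarith

theorem exists_reward_gap {d : ℕ} (hd : 2 ≤ d) {z j : Fin d} (hj : j ≠ z) {Ξ D : ℝ}
    (hD : D ^ 2 = (d : ℝ) - 1) (hD1 : 1 ≤ D) (hΞ0 : 0 < Ξ) (h : Ξ * (√2 + D) < 1) :
    ∃ (a m : ℝ) (J : Finset (Fin d)), z ∉ J ∧ J.Nonempty ∧
      (∀ i ∈ J, ∀ k ∈ J, i ≠ k → m = a) ∧ 0 < a ∧ a ≤ m ∧ m < √2 / 2 ∧ √2 / 2 ≤ m + a ∧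
      a ≤ 4 * Ξ * J.card ∧ Ξ < a * (1 - Ξ * D) := by
  have s2 : √2 ^ 2 = 2 := Real.sq_sqrt (by norm_num)
  have s0 : 0 < √2 := by positivity
  have s3 : √2 ≤ 1.5 := Real.sqrt_le_iff.2 ⟨by norm_num, by norm_num⟩
  have hpos : 0 < 1 - Ξ * D := by nlinarith [mul_pos hΞ0 s0]
  -- The left side is the infimum of admissible `a`, and `√2 / 2` the supremum; the hypothesis on
  -- `Ξ` says precisely that there is room between them.
  have ha0 : Ξ / (1 - Ξ * D) < √2 / 2 := by
    rw [div_lt_iff₀ hpos]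
    nlinarith
  have ha00 : 0 < Ξ / (1 - Ξ * D) := by positivity
  rcases le_or_gt (Ξ * D) (1 / 2) with hc | hc
  -- Here `Ξ / (1 - Ξ D) ≤ 2 Ξ`, so `a < 4 Ξ` is possible and one competitor suffices.
  · obtain ⟨a, h1, h2⟩ := exists_between (lt_min ha0
      (by linarith : Ξ / (1 - Ξ * D) < 2 * (Ξ / (1 - Ξ * D))))
    obtain ⟨m, h3, h4⟩ := exists_between (max_lt (lt_of_lt_of_le h2 (min_le_left _ _))
      (by linarith : √2 / 2 - a < √2 / 2))
    have h5 := (le_max_left _ _).trans_lt h3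
    have h6 := (le_max_right _ _).trans_lt h3
    have h7 : a < 2 * (Ξ / (1 - Ξ * D)) := lt_of_lt_of_le h2 (min_le_right _ _)
    have h8 : Ξ / (1 - Ξ * D) ≤ 2 * Ξ := by
      rw [div_le_iff₀ hpos]
      nlinarith
    refine ⟨a, m, {j}, by simpa using hj.symm, by simp, by simp +contextual, ha00.trans h1, h5.le,
      h4, by linarith, by simp; linarith, (div_lt_iff₀ hpos).1 h1⟩
  -- Now `a` lies between `√2 / 4` and `√2 / 2`, and all `D²` other vertices compete: `4 Ξ D² > 2 D
  -- ≥ 2 > a`.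
  · obtain ⟨a, h1, h2⟩ := exists_between (max_lt ha0 (by linarith : √2 / 2 / 2 < √2 / 2))
    have h3 := (le_max_left _ _).trans_lt h1
    have h4 := (le_max_right _ _).trans_lt h1
    refine ⟨a, a, Finset.univ.erase z, by simp, ⟨j, by simp [hj]⟩, fun _ _ _ _ _ => rfl,
      ha00.trans h3, le_rfl, h2, by linarith, ?_, (div_lt_iff₀ hpos).1 h3⟩
    have hcard : ((Finset.univ.erase z).card : ℝ) = D ^ 2 := by
      rw [Finset.card_erase_of_mem (Finset.mem_univ z), Finset.card_univ, Fintype.card_fin,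
        Nat.cast_sub (by omega), hD]
      simp
    rw [hcard]
    nlinarith

theorem mainTheorem5 :
    ∃ c : ℝ, 0 < c ∧
      ∀ (d : ℕ), 2 ≤ d → ∀ Ξ ε : ℝ, 0 < Ξ → Ξ * (√2 + √((d : ℝ) - 1)) < 1 → Ξ < ε →
        ∀ alg : ℝ → Policy d, IsConsistentAlgorithm alg →
          ∃ (P : SimplexBandit d) (xs : Fin d → ℝ),
            P.IsLPEasy xs ∧
            P.toSafeLP.NondegenerateAt xs ∧
            (d = 2 → P.toSafeLP.Nondegenerate) ∧
            (∀ I : Finset (Row d), P.toSafeLP.IsBIS I → ¬ P.toSafeLP.Assoc I xs →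
              P.toSafeLP.consGap I = 0 ∧
              Ξ ≤ max (P.toSafeLP.effGap xs I) (P.toSafeLP.feasGap I)) ∧
            ∀ᶠ T : ℕ in atTop,
              c * (Real.log T / Ξ) ≤ P.expRegret (alg P.α) xs ε T := by
  refine ⟨1 / 336, by norm_num, fun d hd Ξ ε hΞ0 hΞ _ alg halg => ?_⟩
  have hd1 : (1 : ℝ) ≤ (d : ℝ) - 1 := by
    have : (2 : ℝ) ≤ d := by exact_mod_cast hd
    linarith
  set D := √((d : ℝ) - 1) with hDdef
  have hD : D ^ 2 = (d : ℝ) - 1 := Real.sq_sqrt (by linarith)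
  have hD1 : 1 ≤ D := Real.one_le_sqrt.2 hd1
  let z : Fin d := ⟨0, by omega⟩
  let j : Fin d := ⟨1, by omega⟩
  have hj : j ≠ z := by simp [j, z]
  obtain ⟨a, m, J, hzJ, hJ0, hJ, ha, ham, hm, hma, haJ, hgap⟩ :=
    exists_reward_gap hd hj hD hD1 hΞ0 hΞ
  -- The common risk `b = D⁻¹` is the largest that the norm bound allows.
  have hb : 0 < D⁻¹ := by positivity
  have hgap' : Ξ * D⁻¹ < a * (D⁻¹ - Ξ) := by
    have : a * (D⁻¹ - Ξ) = a * (1 - Ξ * D) * D⁻¹ := by field_simp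
    rw [this]
    exact mul_lt_mul_of_pos_right hgap hb
  have hbd : ((d : ℝ) - 1) * D⁻¹ ^ 2 ≤ 1 := by
    rw [← hD]; field_simp; exact le_rfl
  have hb1 : D⁻¹ ≤ 1 := inv_le_one_of_one_le₀ hD1
  obtain ⟨α, h1, h2, h3, h4⟩ := exists_safety_level hΞ0 ha hb hgap'
  by_cases hd2 : d = 2
  · exact SimplexBandit.exists_instance hzJ hJ0 hJ hΞ0 ha ham hm hma haJ h1 h2.le hb1 hbd
      (fun h => absurd hd2 h) (fun _ => h2) h3 h4 halg
  · exact SimplexBandit.exists_instance hzJ hJ0 hJ hΞ0 ha ham hm hma haJ hb le_rfl hb1 hbd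
      (fun _ => rfl) (fun h => absurd h hd2) hgap'.le (by rw [sub_self]; positivity) halg

end
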